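/- Let $n\ge 0$ and $a<b$. Let $R:[a,b]\to \mathrm{Sym}(n,\mathbb R)$ be continuous, and put $A(t)=\begin{bmatrix}0&I\\R(t)&0\end{bmatrix}$. Let $\Lambda(n)$ be the Lagrangian Grassmannian of $\mathbb R^{2n}=\{(q,p)\}\cong\mathbb C^n$, $q+ip$, let $\sigma=\{0\}\times\mathbb R^n$, and let $\Lambda^k(\sigma)=\{L\in\Lambda(n) : \dim(L\cap\sigma)=k\}$. The Maslov cycle is $\Lambda^{\ge 1}(\sigma)=\bigcup_{k\ge1}\Lambda^k(\sigma)$; its principal stratum $\Lambda^1(\sigma)$ is a hypersurface transversal to the flow $L\mapsto e^{i\theta}L$. For a continuous curve $\gamma:[a,b]\to\Lambda(n)$ with $\gamma(a),\gamma(b)\in\Lambda^0(\sigma)$, the intersection index of $\gamma$ with $\Lambda^{\ge1}(\sigma)$, relative to a co-orientation of $\Lambda^1(\sigma)$, is the number of intersections, counted with sign, of any curve that is homotopic to $\gamma$ with fixed end points, meets $\Lambda^{\ge 1}(\sigma)$ at finitely many times, and at each of them crosses $\Lambda^1(\sigma)$ transversally (in particular it is differentiable there). Let $\mathrm{Ind}^{+}$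 and $\mathrm{Ind}^{-}$ be the indices relative to the co-orientations given by the flows $e^{i\theta}$ and $e^{-i\theta}$, respectively. Let $\tau\in\Lambda(n)$ and, for $t\in[a,b]$, $$\lambda(t)=\{v(t) : v(a)\in\tau,\ v'(s)=A(s)v(s)\text{ for } s\in[a,b]\}.$$ Assume $\lambda(a),\lambda(b)\in\Lambda^0(\sigma)$. Then $\lambda(t)\cap\sigma\ne\{0\}$ for only finitely many $t\in(a,b)$, $\lambda$ is a continuous curve in $\Lambda(n)$, its intersection index with $\Lambda^{\ge1}(\sigma)$ exists and is unique, and $$\mathrm{Ind}^{-}(\lambda)=\sum_{t\in(a,b)}\dim(\lambda(t)\cap\sigma),\qquad\text{equivalently}\qquad \mathrm{Ind}^{+}(\lambda)=-\sum_{t\in(a,b)}\dim(\lambda(t)\cap\sigma).$$ -/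

import Mathlib

open scoped Topology

noncomputable section

namespace MaslovIndex

/-- `ℝ²ⁿ = ℝⁿ × ℝⁿ` with its Euclidean structure.  The coordinates are `(q, p)`:
`q i = x (Sum.inl i)` and `p i = x (Sum.inr i)`. -/
abbrev PhaseSpace (n : ℕ) : Type := EuclideanSpace ℝ (Fin n ⊕ Fin n)

/-- The symplectic form `ω((q,p),(q',p')) = -⟨q,p'⟩ + ⟨p,q'⟩`. -/
def omega {n : ℕ} (x y : PhaseSpace n) : ℝ :=
  ∑ i : Fin n, (-(x (Sum.inl i) * y (Sum.inr i)) + x (Sum.inr i) * y (Sum.inl i))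

/-- Lagrangian subspaces: isotropic subspaces of dimension `n`. -/
def IsLagrangian {n : ℕ} (L : Submodule ℝ (PhaseSpace n)) : Prop :=
  (∀ x ∈ L, ∀ y ∈ L, omega x y = 0) ∧ Module.finrank ℝ L = n

/-- The Lagrangian Grassmannian `Λ(n)`. -/
def LagrangianGrassmannian (n : ℕ) : Type :=
  {L : Submodule ℝ (PhaseSpace n) // IsLagrangian L}

/-- `Λ(n)` carries the topology of the Grassmannian: a subspace is identified with the orthogonal
projection onto it, and the topology is induced by the operator norm. -/
instance (n : ℕ) : TopologicalSpace (LagrangianGrassmannian n) :=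
  TopologicalSpace.induced
    (fun L => (L.1.starProjection : PhaseSpace n →L[ℝ] PhaseSpace n)) inferInstance

/-- The vertical Lagrangian `σ = {0} × ℝⁿ`. -/
def sigma (n : ℕ) : Submodule ℝ (PhaseSpace n) where
  carrier := {x | ∀ i : Fin n, x (Sum.inl i) = 0}
  zero_mem' := by intro i; simp
  add_mem' := by
    intro x y hx hy i
    simp [hx i, hy i]
  smul_mem' := by
    intro c x hx i
    simp [hx i]

/-- `dim (L ∩ σ)`. -/
def interDim {n : ℕ} (L : Submodule ℝ (PhaseSpace n)) : ℕ :=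
  Module.finrank ℝ (L ⊓ sigma n : Submodule ℝ (PhaseSpace n))

/-- The stratum `Λᵏ(σ) = {L ∈ Λ(n) | dim (L ∩ σ) = k}`. -/
def stratum (n k : ℕ) : Set (LagrangianGrassmannian n) := {L | interDim L.1 = k}

/-- The Maslov cycle `Λ^{≥1}(σ) = ⋃_{k ≥ 1} Λᵏ(σ)`. -/
def maslovCycle (n : ℕ) : Set (LagrangianGrassmannian n) := ⋃ k ≥ 1, stratum n k

/-- The graph `λ_S = {(q, S q)}` of a matrix `S`. -/
def graph {n : ℕ} (S : Matrix (Fin n) (Fin n) ℝ) : Submodule ℝ (PhaseSpace n) where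
  carrier := {x | ∀ i : Fin n, x (Sum.inr i) = ∑ j : Fin n, S i j * x (Sum.inl j)}
  zero_mem' := by intro i; simp
  add_mem' := by
    intro x y hx hy i
    simp [hx i, hy i, mul_add, Finset.sum_add_distrib]
  smul_mem' := by
    intro c x hx i
    simp [hx i, Finset.mul_sum, mul_left_comm]

/-- The map `J_K`: it sends `(qⁱ, pⁱ)` to `(-pⁱ, qⁱ)` for `i ∈ K` and fixes `(qⁱ, pⁱ)` for
`i ∉ K`, that is, multiplication by the imaginary unit in the coordinates `qⁱ + √-1 pⁱ`,
`i ∈ K`. -/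
def rotation {n : ℕ} (K : Finset (Fin n)) : PhaseSpace n →ₗ[ℝ] PhaseSpace n where
  toFun x := WithLp.toLp 2 (Sum.elim
    (fun i => if i ∈ K then -x (Sum.inr i) else x (Sum.inl i))
    (fun i => if i ∈ K then x (Sum.inl i) else x (Sum.inr i)))
  map_add' := by
    intro x y
    ext i
    rcases i with i | i <;> by_cases h : i ∈ K <;> simp [h, add_comm]
  map_smul' := by
    intro c x
    ext i
    rcases i with i | i <;> by_cases h : i ∈ K <;> simp [h]

/-- The (inverse) chart `φ_K(S) = J_K λ_S`, defined for symmetric `S`; its image is the set of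
Lagrangians transversal to `J_K σ`. -/
def chart {n : ℕ} (K : Finset (Fin n)) (S : Matrix (Fin n) (Fin n) ℝ) :
    Submodule ℝ (PhaseSpace n) :=
  (graph S).map (rotation K)

/-- A continuous curve `η : [a,b] → Λ(n)` intersects the Maslov cycle at the time `t`
transversally, at a point of the principal stratum `Λ¹(σ)`, with sign `s = ±1`.

In a chart `φ_K` with `K = {κ}` around `η t`, the Maslov cycle is the hypersurface `S_κκ = 0`.
Transversality means that the coordinates `S` of the curve are differentiable at `t`
with `S'_κκ(t) ≠ 0`.  Along the flow `θ ↦ e^{iθ} L` the coordinates satisfy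
`S' = 1 + S²`, hence `S'_κκ > 0`: this flow is transversal to `Λ¹(σ)` and co-orients it by
`S'_κκ > 0`, in every chart.  The unit `o = ±1` selects the co-orientation:
`o = 1` is the one given by the flow `θ ↦ e^{iθ} L`, and `o = -1` is the opposite one, given by
the flow `θ ↦ e^{-iθ} L`. -/
def CrossesWithSign (o : ℤˣ) {n : ℕ} {a b : ℝ} (η : C(Set.Icc a b, LagrangianGrassmannian n))
    (t : Set.Icc a b) (s : ℤˣ) : Prop :=
  η t ∈ stratum n 1 ∧
  ∃ (κ : Fin n) (S : ℝ → Matrix (Fin n) (Fin n) ℝ) (S' : Matrix (Fin n) (Fin n) ℝ),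
    (∀ᶠ u : Set.Icc a b in 𝓝 t, (S u).IsSymm ∧ (η u).1 = chart {κ} (S u)) ∧
    (∀ i j, HasDerivAt (fun u => S u i j) (S' i j) (t : ℝ)) ∧
    0 < (((o * s : ℤˣ) : ℤ) : ℝ) * S' κ κ

/-- The curve `η` meets the Maslov cycle at finitely many times, transversally and in the
principal stratum at each of them, and `m` is the number of these intersections counted with
sign. -/
def IsSignedCount (o : ℤˣ) {n : ℕ} {a b : ℝ} (η : C(Set.Icc a b, LagrangianGrassmannian n))
    (m : ℤ) : Prop :=
  ∃ (T : Finset (Set.Icc a b)) (s : Set.Icc a b → ℤˣ),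
    (∀ t, t ∈ T ↔ η t ∈ maslovCycle n) ∧
    (∀ t ∈ T, CrossesWithSign o η t (s t)) ∧
    m = ∑ t ∈ T, ((s t : ℤˣ) : ℤ)

/-- `m` is an intersection index with the Maslov cycle, co-oriented according to `o`, of the
continuous curve `γ : [a,b] → Λ(n)`, whose end points are in `Λ⁰(σ)`: after a homotopy of `γ` with
fixed end points all intersections with the cycle are transversal, and `m` is their signed
number.  (Existence and uniqueness of `m` are not part of this definition.) -/
def IsIntersectionIndex (o : ℤˣ) {n : ℕ} {a b : ℝ}
    (γ : C(Set.Icc a b, LagrangianGrassmannian n)) (m : ℤ) : Prop :=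
  (∀ t : Set.Icc a b, ((t : ℝ) = a ∨ (t : ℝ) = b) → γ t ∈ stratum n 0) ∧
  ∃ η : C(Set.Icc a b, LagrangianGrassmannian n),
    γ.HomotopicRel η {t | (t : ℝ) = a ∨ (t : ℝ) = b} ∧ IsSignedCount o η m

/-- The matrix `A = [[0, I], [R, 0]]`. -/
def systemMatrix {n : ℕ} (R : Matrix (Fin n) (Fin n) ℝ) :
    Matrix (Fin n ⊕ Fin n) (Fin n ⊕ Fin n) ℝ :=
  Matrix.fromBlocks 0 1 R 0

/-- `v` solves `v'(t) = A(t) v(t)` on `[a,b]`. -/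
def IsSolution {n : ℕ} (R : ℝ → Matrix (Fin n) (Fin n) ℝ) (a b : ℝ)
    (v : ℝ → PhaseSpace n) : Prop :=
  ∀ t ∈ Set.Icc a b,
    HasDerivWithinAt v (Matrix.toEuclideanLin (systemMatrix (R t)) (v t)) (Set.Icc a b) t

/-- `λ(t) = {v(t) | v(a) ∈ τ, v' = A v on [a,b]}`. -/
def flow {n : ℕ} (R : ℝ → Matrix (Fin n) (Fin n) ℝ) (a b : ℝ)
    (τ : Submodule ℝ (PhaseSpace n)) (t : ℝ) : Submodule ℝ (PhaseSpace n) where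
  carrier := {x | ∃ v : ℝ → PhaseSpace n, v a ∈ τ ∧ IsSolution R a b v ∧ v t = x}
  zero_mem' := by
    refine ⟨fun _ => 0, τ.zero_mem, ?_, rfl⟩
    intro t _
    simpa using hasDerivWithinAt_const t (Set.Icc a b) (0 : PhaseSpace n)
  add_mem' := by
    rintro x y ⟨v, hv, hv', rfl⟩ ⟨w, hw, hw', rfl⟩
    refine ⟨fun t => v t + w t, τ.add_mem hv hw, ?_, rfl⟩
    intro t ht
    simpa only [map_add] using (hv' t ht).fun_add (hw' t ht)
  smul_mem' := by
    rintro c x ⟨v, hv, hv', rfl⟩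
    refine ⟨fun t => c • v t, τ.smul_mem c hv, ?_, rfl⟩
    intro t ht
    simpa only [map_smul] using (hv' t ht).fun_const_smul c

end MaslovIndex

end

open MaslovIndex

noncomputable section

namespace MaslovIndex

/-! ### Linear ordinary differential equations -/

/-! Existence and value of the index. Near a time `t`, the curve is written in a chart `φ_K` adapted
to `λ(t)`: `K` has `dim (λ(t) ∩ σ)` elements and the `K`-block of the coordinates `S` vanishes at
`t` (`exists_adapted_chart`). If the columns of `X` and `Y` are the base and fibre coordinates of a
frame of solutions, then `S = Y X⁻¹`. Differentiating at `t`, the `K`-block of `S'` is that of `-(1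
+ S χ S)`, where `χ` projects onto the coordinates outside `K`. The matrix `R` drops out, so every
crossing form is negative definite, whatever `R` is (`degenerateCrossing_flow`). Hence crossings are
isolated, and finite in number by compactness. Around a crossing of dimension `k` the `K`-block is
positive before and negative after. A short piece of the curve can therefore be replaced, by a
straight-line homotopy in the chart, by a path on which `k` diagonal entries pass downwards through
zero one at a time (`DegenerateCrossing.exists_resolution`). This yields `k` transversal crossings,
all against the flow `e^{iθ}`; doing so at each crossing gives `exists_simple_representative`.

Uniqueness. The determinant of the Souriau matrix `W` is a continuous function on `Λ(n)` with values
in `ℂ \ {0}`. On `Λ⁰(σ)`, which is a copy of the symmetric matrices, it has a continuous logarithm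
`graphLog`, and this jumps by `-2πi` when `Λ¹(σ)` is crossed in the direction of `e^{iθ}`
(`graphLog_chartPoint_sub`). If `θ` is a continuous logarithm of `det W` along a curve, then `θ -
graphLog` is constant between crossings and jumps by `±2πi` at each of them, so its total change is
`2πi` times the signed count (`IsSignedCount.eq_log_sub`). A logarithm over the whole homotopy shows
that this change is a homotopy invariant (`IsIntersectionIndex.unique`). -/

/-- Truncation of every coordinate to `[-M, M]`. -/
def clamp {ι : Type*} (M : ℝ) (x : EuclideanSpace ℝ ι) : EuclideanSpace ℝ ι :=
  WithLp.toLp 2 fun i => max (-M) (min M (x i))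

/-- Truncating the unknown makes a linear field bounded and does not increase its Lipschitz
constant, so Picard–Lindelöf applies on all of `[a, b]` at once; a Grönwall bound then shows that
the truncation was never active. -/
lemma clamp_lipschitz {ι : Type*} [Fintype ι] (M : ℝ) :
    LipschitzWith 1 (clamp M : EuclideanSpace ℝ ι → EuclideanSpace ℝ ι) := by
  refine LipschitzWith.of_dist_le_mul fun x y => ?_
  rw [NNReal.coe_one, one_mul, EuclideanSpace.dist_eq, EuclideanSpace.dist_eq]
  refine Real.sqrt_le_sqrt (Finset.sum_le_sum fun i _ => ?_)
  refine pow_le_pow_left₀ dist_nonneg ?_ 2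
  simp only [clamp, Real.dist_eq]
  refine (abs_max_sub_max_le_max _ _ _ _).trans ?_
  rw [sub_self, abs_zero]
  refine max_le (abs_nonneg _) ((abs_min_sub_min_le_max _ _ _ _).trans ?_)
  simp

lemma clamp_eq_self {ι : Type*} [Fintype ι] {M : ℝ} {x : EuclideanSpace ℝ ι} (h : ‖x‖ ≤ M) :
    clamp M x = x := by
  ext i
  have h1 : |x i| ≤ M := by simpa using (PiLp.norm_apply_le x i).trans h
  rw [abs_le] at h1
  simp [clamp, h1.1, h1.2]

lemma norm_clamp_le {ι : Type*} [Fintype ι] {M : ℝ} (hM : 0 ≤ M) (x : EuclideanSpace ℝ ι) :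
    ‖clamp M x‖ ≤ √(Fintype.card ι * M ^ 2) := by
  rw [EuclideanSpace.norm_eq]
  refine Real.sqrt_le_sqrt ((Finset.sum_le_sum (g := fun _ => M ^ 2) fun i _ => ?_).trans ?_)
  · refine pow_le_pow_left₀ (norm_nonneg _) ?_ 2
    rw [Real.norm_eq_abs, abs_le]
    exact ⟨le_max_left _ _, max_le (by linarith) (min_le_left _ _)⟩
  · simp

lemma clamp_zero {ι : Type*} {M : ℝ} (hM : 0 ≤ M) : clamp M (0 : EuclideanSpace ℝ ι) = 0 := by
  ext i
  simp [clamp, hM]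

lemma norm_clamp_le_norm {ι : Type*} [Fintype ι] {M : ℝ} (hM : 0 ≤ M) (x : EuclideanSpace ℝ ι) :
    ‖clamp M x‖ ≤ ‖x‖ := by
  simpa [clamp_zero hM] using (clamp_lipschitz M).dist_le_mul x 0

section LinearODE

variable {ι : Type*} [Fintype ι] {a b : ℝ}
  {A : ℝ → EuclideanSpace ℝ ι →L[ℝ] EuclideanSpace ℝ ι}

lemma exists_bound_of_continuousOn (hA : ContinuousOn A (Set.Icc a b)) :
    ∃ K : NNReal, ∀ t ∈ Set.Icc a b, ‖A t‖ ≤ K := by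
  obtain ⟨C, hC⟩ := isCompact_Icc.exists_bound_of_continuousOn hA
  exact ⟨C.toNNReal, fun t ht => (hC t ht).trans (Real.le_coe_toNNReal C)⟩

lemma hasDerivWithinAt_Ici_of_Icc {E : Type*} [NormedAddCommGroup E] [NormedSpace ℝ E]
    {v : ℝ → E} {v' : E} {t : ℝ} (ht : t ∈ Set.Ico a b)
    (h : HasDerivWithinAt v v' (Set.Icc a b) t) : HasDerivWithinAt v v' (Set.Ici t) t :=
  (h.mono (Set.Icc_subset_Icc_left ht.1)).mono_of_mem_nhdsWithin (Icc_mem_nhdsGE ht.2)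

lemma hasDerivWithinAt_Iic_of_Icc {E : Type*} [NormedAddCommGroup E] [NormedSpace ℝ E]
    {v : ℝ → E} {v' : E} {t : ℝ} (ht : t ∈ Set.Ioc a b)
    (h : HasDerivWithinAt v v' (Set.Icc a b) t) : HasDerivWithinAt v v' (Set.Iic t) t :=
  (h.mono (Set.Icc_subset_Icc_right ht.2)).mono_of_mem_nhdsWithin (Icc_mem_nhdsLE ht.1)

/-- Linear equations with continuous coefficients have solutions on the whole interval. -/
theorem exists_linear_solution (hab : a ≤ b) (hA : ContinuousOn A (Set.Icc a b))
    (x₀ : EuclideanSpace ℝ ι) :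
    ∃ v : ℝ → EuclideanSpace ℝ ι, v a = x₀ ∧
      ∀ t ∈ Set.Icc a b, HasDerivWithinAt v (A t (v t)) (Set.Icc a b) t := by
  obtain ⟨K, hK⟩ := exists_bound_of_continuousOn hA
  -- The Grönwall bound of the linear equation: solutions starting at `x₀` never reach beyond this
  -- height.
  set M : ℝ := ‖x₀‖ * Real.exp (K * (b - a)) with hM
  have hM0 : 0 ≤ M := by positivity
  -- `L` bounds the truncated field. The radius `L (b - a)` used below is what speed `L` can cover,
  -- so no smallness of `b - a` is needed.
  set L : NNReal := K * (√(Fintype.card ι * M ^ 2)).toNNReal with hL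
  have hpl : IsPicardLindelof (fun t x => A t (clamp M x)) (⟨a, Set.left_mem_Icc.2 hab⟩ :
      Set.Icc a b) x₀ (L * (b - a).toNNReal) 0 L K := by
    refine ⟨fun t ht => ?_, fun x _ => hA.clm_apply continuousOn_const, fun t ht x _ => ?_, ?_⟩
    · have h1 : LipschitzWith ‖A t‖₊ (A t) := (A t).lipschitz
      have h2 := (h1.weaken (hK t ht)).comp (clamp_lipschitz (ι := ι) M)
      rw [mul_one] at h2
      exact h2.lipschitzOnWith
    · refine ((A t).le_opNorm _).trans ?_
      rw [hL, NNReal.coe_mul]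
      exact mul_le_mul (hK t ht) ((norm_clamp_le hM0 x).trans (Real.le_coe_toNNReal _))
        (norm_nonneg _) K.2
    · simp [hab]
  obtain ⟨v, hv0, hv⟩ := hpl.exists_eq_forall_mem_Icc_hasDerivWithinAt₀
  refine ⟨v, hv0, ?_⟩
  have hcont : ContinuousOn v (Set.Icc a b) := fun t ht => (hv t ht).continuousWithinAt
  have hbound : ∀ t ∈ Set.Icc a b, ‖v t‖ ≤ M := by
    intro t ht
    have h := norm_le_gronwallBound_of_norm_deriv_right_le (δ := ‖x₀‖) (K := K) (ε := 0) hcont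
      (fun t ht => hasDerivWithinAt_Ici_of_Icc ht (hv t (Set.Ico_subset_Icc_self ht)))
      (by rw [← hv0]) (fun t ht => by
        rw [add_zero]
        exact ((A t).le_opNorm _).trans (mul_le_mul (hK t (Set.Ico_subset_Icc_self ht))
          (norm_clamp_le_norm hM0 _) (norm_nonneg _) K.2)) t ht
    rw [gronwallBound_ε0] at h
    refine h.trans (mul_le_mul_of_nonneg_left (Real.exp_le_exp.2 ?_) (norm_nonneg _))
    exact mul_le_mul_of_nonneg_left (by linarith [ht.2]) K.2
  intro t ht
  simpa only [clamp_eq_self (hbound t ht)] using hv t ht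

/-- A solution of a linear equation which vanishes somewhere is zero. -/
theorem linear_solution_eq_zero (hA : ContinuousOn A (Set.Icc a b))
    {v : ℝ → EuclideanSpace ℝ ι}
    (hv : ∀ t ∈ Set.Icc a b, HasDerivWithinAt v (A t (v t)) (Set.Icc a b) t)
    {t₀ : ℝ} (ht₀ : t₀ ∈ Set.Icc a b) (h0 : v t₀ = 0) : ∀ t ∈ Set.Icc a b, v t = 0 := by
  obtain ⟨K, hK⟩ := exists_bound_of_continuousOn hA
  have hlip : ∀ t ∈ Set.Icc a b, LipschitzOnWith K (fun x => A t x) Set.univ := fun t ht =>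
    ((A t).lipschitz.weaken (hK t ht)).lipschitzOnWith
  have hcont : ContinuousOn v (Set.Icc a b) := fun t ht => (hv t ht).continuousWithinAt
  intro t ht
  rcases le_total t₀ t with h | h
  · refine ODE_solution_unique_of_mem_Icc_right (a := t₀) (b := b) (v := fun t x => A t x)
      (s := fun _ => Set.univ) (K := K) (g := fun _ => 0)
      (fun s hs => hlip s ⟨ht₀.1.trans hs.1, hs.2.le⟩)
      (hcont.mono (Set.Icc_subset_Icc_left ht₀.1)) (fun s hs => ?_) (fun _ _ => trivial)
      continuousOn_const (fun s _ => ?_) (fun _ _ => trivial) h0 ⟨h, ht.2⟩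
    · exact hasDerivWithinAt_Ici_of_Icc ⟨ht₀.1.trans hs.1, hs.2⟩ (hv s ⟨ht₀.1.trans hs.1, hs.2.le⟩)
    · simpa using hasDerivWithinAt_const s (Set.Ici s) (0 : EuclideanSpace ℝ ι)
  · refine ODE_solution_unique_of_mem_Icc_left (a := a) (b := t₀) (v := fun t x => A t x)
      (s := fun _ => Set.univ) (K := K) (g := fun _ => 0)
      (fun s hs => hlip s ⟨hs.1.le, hs.2.trans ht₀.2⟩)
      (hcont.mono (Set.Icc_subset_Icc_right ht₀.2)) (fun s hs => ?_) (fun _ _ => trivial)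
      continuousOn_const (fun s _ => ?_) (fun _ _ => trivial) h0 ⟨ht.1, h⟩
    · exact hasDerivWithinAt_Iic_of_Icc ⟨hs.1, hs.2.trans ht₀.2⟩ (hv s ⟨hs.1.le, hs.2.trans ht₀.2⟩)
    · simpa using hasDerivWithinAt_const s (Set.Iic s) (0 : EuclideanSpace ℝ ι)

end LinearODE

/-! ### Symplectic coordinates adapted to a chart -/

variable {n : ℕ}

/-- The base coordinates of the chart `φ_K`, that is, the `q`-coordinates of `J_K⁻¹ x`. -/
def baseCoord (K : Finset (Fin n)) : PhaseSpace n →ₗ[ℝ] (Fin n → ℝ) where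
  toFun x i := if i ∈ K then x (Sum.inr i) else x (Sum.inl i)
  map_add' x y := by
    ext i
    by_cases h : i ∈ K <;> simp [h]
  map_smul' c x := by
    ext i
    by_cases h : i ∈ K <;> simp [h]

/-- The fibre coordinates of the chart `φ_K`, that is, the `p`-coordinates of `J_K⁻¹ x`. -/
def fibreCoord (K : Finset (Fin n)) : PhaseSpace n →ₗ[ℝ] (Fin n → ℝ) where
  toFun x i := if i ∈ K then -x (Sum.inl i) else x (Sum.inr i)
  map_add' x y := by
    ext i
    by_cases h : i ∈ K <;> simp [h, add_comm]
  map_smul' c x := by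
    ext i
    by_cases h : i ∈ K <;> simp [h]

/-- The point with given coordinates in the chart `φ_K`. -/
def ofCoord (K : Finset (Fin n)) (u v : Fin n → ℝ) : PhaseSpace n :=
  WithLp.toLp 2 (Sum.elim (fun i => if i ∈ K then -v i else u i)
    (fun i => if i ∈ K then u i else v i))

lemma baseCoord_apply (K : Finset (Fin n)) (x : PhaseSpace n) (i : Fin n) :
    baseCoord K x i = if i ∈ K then x (Sum.inr i) else x (Sum.inl i) := rfl

lemma fibreCoord_apply (K : Finset (Fin n)) (x : PhaseSpace n) (i : Fin n) :
    fibreCoord K x i = if i ∈ K then -x (Sum.inl i) else x (Sum.inr i) := rfl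

@[simp] lemma baseCoord_ofCoord (K : Finset (Fin n)) (u v : Fin n → ℝ) :
    baseCoord K (ofCoord K u v) = u := by
  ext i
  by_cases h : i ∈ K <;> simp [baseCoord_apply, ofCoord, h]

@[simp] lemma fibreCoord_ofCoord (K : Finset (Fin n)) (u v : Fin n → ℝ) :
    fibreCoord K (ofCoord K u v) = v := by
  ext i
  by_cases h : i ∈ K <;> simp [fibreCoord_apply, ofCoord, h]

lemma ofCoord_coord (K : Finset (Fin n)) (x : PhaseSpace n) :
    ofCoord K (baseCoord K x) (fibreCoord K x) = x := by
  ext i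
  rcases i with i | i <;> by_cases h : i ∈ K <;>
    simp [baseCoord_apply, fibreCoord_apply, ofCoord, h]

lemma eq_zero_of_coord (K : Finset (Fin n)) {x : PhaseSpace n} (h1 : baseCoord K x = 0)
    (h2 : fibreCoord K x = 0) : x = 0 := by
  rw [← ofCoord_coord K x, h1, h2]
  ext i
  rcases i with i | i <;> simp [ofCoord]

lemma rotation_apply (K : Finset (Fin n)) (x : PhaseSpace n) :
    rotation K x = ofCoord K (fun i => x (Sum.inl i)) (fun i => x (Sum.inr i)) := rfl

lemma mem_graph {S : Matrix (Fin n) (Fin n) ℝ} {x : PhaseSpace n} :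
    x ∈ graph S ↔ (fun i => x (Sum.inr i)) = S.mulVec fun i => x (Sum.inl i) :=
  ⟨fun h => funext h, fun h i => congrFun h i⟩

lemma mem_chart {K : Finset (Fin n)} {S : Matrix (Fin n) (Fin n) ℝ} {x : PhaseSpace n} :
    x ∈ chart K S ↔ fibreCoord K x = S.mulVec (baseCoord K x) := by
  constructor
  · rintro ⟨y, hy, rfl⟩
    rw [rotation_apply, fibreCoord_ofCoord, baseCoord_ofCoord]
    exact mem_graph.1 hy
  · intro h
    refine ⟨WithLp.toLp 2 (Sum.elim (baseCoord K x) (fibreCoord K x)), mem_graph.2 ?_, ?_⟩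
    · simpa using h
    · rw [rotation_apply]
      simpa using ofCoord_coord K x

/-- The map `J_K` is symplectic, so `ω` has the same expression in the coordinates of every chart.
-/
lemma omega_eq_coord (K : Finset (Fin n)) (x y : PhaseSpace n) :
    omega x y = fibreCoord K x ⬝ᵥ baseCoord K y - baseCoord K x ⬝ᵥ fibreCoord K y := by
  rw [omega, dotProduct, dotProduct, ← Finset.sum_sub_distrib]
  refine Finset.sum_congr rfl fun i _ => ?_
  by_cases h : i ∈ K
  · simp [baseCoord_apply, fibreCoord_apply, h]
  · simp [baseCoord_apply, fibreCoord_apply, h]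
    ring

/-- The entry `q i` is a base coordinate for `i ∉ K` and minus a fibre coordinate for `i ∈ K`.
Consequently `chart K S ⊓ sigma n` corresponds to the kernel of the `K`-block of `S`. -/
lemma mem_sigma_iff_coord (K : Finset (Fin n)) {x : PhaseSpace n} :
    x ∈ sigma n ↔ (∀ i ∉ K, baseCoord K x i = 0) ∧ ∀ i ∈ K, fibreCoord K x i = 0 := by
  change (∀ i, x (Sum.inl i) = 0) ↔ _
  constructor
  · intro h
    exact ⟨fun i hi => by simp [baseCoord_apply, hi, h i],
      fun i hi => by simp [fibreCoord_apply, hi, h i]⟩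
  · rintro ⟨h1, h2⟩ i
    by_cases hi : i ∈ K
    · simpa [fibreCoord_apply, hi] using h2 i hi
    · simpa [baseCoord_apply, hi] using h1 i hi

/-- Isotropy, tested on the points above two standard basis vectors, compares `S i j` with `S j i`.
-/
lemma isSymm_of_isotropic {K : Finset (Fin n)} {S : Matrix (Fin n) (Fin n) ℝ}
    (h : ∀ x ∈ chart K S, ∀ y ∈ chart K S, omega x y = 0) : S.IsSymm := by
  ext i j
  have hm : ∀ u, ofCoord K u (S.mulVec u) ∈ chart K S := fun u => mem_chart.2 (by simp)
  have := h _ (hm (Pi.single i 1)) _ (hm (Pi.single j 1))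
  rw [omega_eq_coord K] at this
  simp at this
  simp only [Matrix.transpose_apply]
  linarith

/-- The base coordinates identify a chart Lagrangian with `ℝⁿ`. -/
def chartEquiv (K : Finset (Fin n)) (S : Matrix (Fin n) (Fin n) ℝ) :
    chart K S ≃ₗ[ℝ] (Fin n → ℝ) :=
  LinearEquiv.ofBijective ((baseCoord K).domRestrict (chart K S)) <| by
    constructor
    · rw [← LinearMap.ker_eq_bot, LinearMap.ker_eq_bot']
      rintro ⟨x, hx⟩ h
      have h1 : baseCoord K x = 0 := h
      have h2 := mem_chart.1 hx
      rw [h1, Matrix.mulVec_zero] at h2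
      exact Subtype.ext (eq_zero_of_coord K h1 h2)
    · intro u
      exact ⟨⟨ofCoord K u (S.mulVec u), mem_chart.2 (by simp)⟩, by simp⟩

lemma isLagrangian_chart (K : Finset (Fin n)) {S : Matrix (Fin n) (Fin n) ℝ} (hS : S.IsSymm) :
    IsLagrangian (chart K S) := by
  refine ⟨fun x hx y hy => ?_, by simp [(chartEquiv K S).finrank_eq]⟩
  rw [omega_eq_coord K, mem_chart.1 hx, mem_chart.1 hy, Matrix.dotProduct_mulVec,
    ← Matrix.mulVec_transpose, hS.eq, sub_self]

/-- Injectivity and `dim L = n` make `L` a graph over the base coordinates; isotropy makes the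
matrix of the graph symmetric. -/
lemma exists_chart_of_injective {K : Finset (Fin n)} {L : Submodule ℝ (PhaseSpace n)}
    (hL : IsLagrangian L) (h : ∀ x ∈ L, baseCoord K x = 0 → x = 0) :
    ∃ S : Matrix (Fin n) (Fin n) ℝ, S.IsSymm ∧ L = chart K S := by
  have hinj : Function.Injective ((baseCoord K).domRestrict L) := by
    rw [← LinearMap.ker_eq_bot, LinearMap.ker_eq_bot']
    rintro ⟨x, hx⟩ h'
    exact Subtype.ext (h x hx h')
  have hfr : Module.finrank ℝ L = Module.finrank ℝ (Fin n → ℝ) := by simp [hL.2]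
  let e : L ≃ₗ[ℝ] (Fin n → ℝ) := LinearEquiv.ofInjectiveOfFinrankEq _ hinj hfr
  have he : ∀ x, e x = baseCoord K x := fun x => rfl
  let S := LinearMap.toMatrix' ((fibreCoord K ∘ₗ L.subtype) ∘ₗ e.symm.toLinearMap)
  have hS : ∀ u, S.mulVec u = fibreCoord K (e.symm u) := fun u => by
    simp [S, LinearMap.toMatrix'_mulVec]
  have hLS : L = chart K S := by
    refine Submodule.eq_of_le_of_finrank_eq (fun x hx => mem_chart.2 ?_) ?_
    · rw [hS, ← he ⟨x, hx⟩, e.symm_apply_apply]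
    · rw [hL.2, (chartEquiv K S).finrank_eq]
      simp
  exact ⟨S, isSymm_of_isotropic (K := K) (hLS ▸ hL.1), hLS⟩

/-- Every Lagrangian `L` lies in a chart `φ_K` with `|K| = dim (L ∩ σ)`, and then the `K`-block of
its coordinates vanishes. -/
theorem exists_adapted_chart {L : Submodule ℝ (PhaseSpace n)} (hL : IsLagrangian L) :
    ∃ (K : Finset (Fin n)) (S : Matrix (Fin n) (Fin n) ℝ), S.IsSymm ∧ L = chart K S ∧
      K.card = interDim L ∧ ∀ i ∈ K, ∀ j ∈ K, S i j = 0 := by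
  classical
  -- `K` is good if the momenta with index in `K` separate the points of `L ∩ σ`. For a minimal such
  -- `K` they are linear coordinates on `L ∩ σ`, which gives the cardinality.
  let good : Finset (Fin n) → Prop := fun K =>
    ∀ x ∈ L ⊓ sigma n, (∀ i ∈ K, x (Sum.inr i) = 0) → x = 0
  have huniv : good Finset.univ := by
    intro x hx h
    ext i
    rcases i with i | i
    · exact hx.2 i
    · exact h i (Finset.mem_univ i)
  obtain ⟨K, hK⟩ := (Set.toFinite {K | good K}).exists_minimal ⟨_, huniv⟩
  have hKg : good K := hK.prop
  -- By minimality, dropping `i` leaves some nonzero vector of `L ∩ σ` undetected; normalised, it is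
  -- the dual basis vector `d i`.
  have hdual : ∀ i ∈ K, ∃ x ∈ L ⊓ sigma n, ∀ j ∈ K, x (Sum.inr j) = if j = i then 1 else 0 := by
    intro i hi
    have hnot : ¬ good (K.erase i) := fun hg =>
      (Finset.erase_ssubset hi).not_ge (hK.le_of_le hg (Finset.erase_subset i K))
    simp only [good, not_forall] at hnot
    obtain ⟨x, hx, hx0, hne⟩ := hnot
    have hxi : x (Sum.inr i) ≠ 0 := by
      intro h0
      refine hne (hKg x hx fun j hj => ?_)
      by_cases hji : j = i
      · rw [hji, h0]
      · exact hx0 j (Finset.mem_erase.2 ⟨hji, hj⟩)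
    refine ⟨(x (Sum.inr i))⁻¹ • x, Submodule.smul_mem _ _ hx, fun j hj => ?_⟩
    by_cases hji : j = i
    · simp [hji, hxi]
    · simp [hji, hx0 j (Finset.mem_erase.2 ⟨hji, hj⟩)]
  choose! d hd hd' using hdual
  obtain ⟨S, hS, hLS⟩ := exists_chart_of_injective (K := K) hL (by
    intro x hx hx0
    have hinl : ∀ i, x (Sum.inl i) = 0 := by
      intro i
      by_cases hi : i ∈ K
      -- The base coordinates of `d i` are the `i`-th basis vector and those of `x` vanish, so `ω(x,
      -- d i) = 0` reads `-x (Sum.inl i) = 0`.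
      · have h := hL.1 x hx (d i) (hd i hi).1
        rw [omega_eq_coord K, hx0, zero_dotProduct, sub_zero, dotProduct,
          Finset.sum_eq_single i] at h
        · simpa [fibreCoord_apply, baseCoord_apply, hi, hd' i hi i hi] using h
        · intro j _ hji
          by_cases hj : j ∈ K
          · simp [baseCoord_apply, hj, hd' i hi j hj, hji]
          · have : (d i) (Sum.inl j) = 0 := (hd i hi).2 j
            simp [baseCoord_apply, hj, this]
        · simp
      · simpa [baseCoord_apply, hi] using congrFun hx0 i
    exact hKg x ⟨hx, hinl⟩ fun i hi => by simpa [baseCoord_apply, hi] using congrFun hx0 i)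
  refine ⟨K, S, hS, hLS, ?_, fun i hi j hj => ?_⟩
  · let f : (L ⊓ sigma n : Submodule ℝ (PhaseSpace n)) →ₗ[ℝ] (K → ℝ) :=
      { toFun := fun x i => x.1 (Sum.inr i.1)
        map_add' := fun x y => by ext i; simp
        map_smul' := fun c x => by ext i; simp }
    have hf : Function.Bijective f := by
      constructor
      · rw [← LinearMap.ker_eq_bot, LinearMap.ker_eq_bot']
        intro x hx
        exact Subtype.ext (hKg x.1 x.2 fun i hi => congrFun hx ⟨i, hi⟩)
      · intro c
        refine ⟨⟨∑ i : K, c i • d i, Submodule.sum_mem _ fun i _ =>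
          Submodule.smul_mem _ _ (hd i i.2)⟩, ?_⟩
        ext j
        have : ∀ i : K, (d i) (Sum.inr j.1) = if j = i then 1 else 0 := fun i => by
          rw [hd' i i.2 j j.2]
          simp only [Subtype.ext_iff]
        change (∑ i : K, c i • d i) (Sum.inr j.1) = c j
        rw [WithLp.ofLp_sum, Finset.sum_apply]
        simp_rw [PiLp.smul_apply, this, smul_eq_mul]
        simp
    have := (LinearEquiv.ofBijective f hf).finrank_eq
    rw [interDim, this]
    simp
  -- The fibre coordinates of `d j` form column `j` of `S`; those with index in `K` are entries `-q
  -- i`, which are zero on `σ`.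
  · have h := mem_chart.1 (hLS ▸ (hd j hj).1)
    have hb : baseCoord K (d j) = Pi.single j 1 := by
      ext l
      by_cases hl : l ∈ K
      · simp [baseCoord_apply, hl, hd' j hj l hl, Pi.single_apply]
      · have h0 : (d j) (Sum.inl l) = 0 := (hd j hj).2 l
        have hlj : l ≠ j := fun h => hl (h ▸ hj)
        simp [baseCoord_apply, hl, h0, hlj]
    rw [hb, Matrix.mulVec_single_one] at h
    have := congrFun h i
    have h0 : (d j) (Sum.inl i) = 0 := (hd j hj).2 i
    simpa [fibreCoord_apply, hi, h0] using this.symm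

/-! ### Intersections with `σ` in a chart -/

lemma interDim_eq_zero_iff {L : Submodule ℝ (PhaseSpace n)} :
    interDim L = 0 ↔ ∀ x ∈ L, x ∈ sigma n → x = 0 := by
  rw [interDim, Submodule.finrank_eq_zero, Submodule.eq_bot_iff]
  exact ⟨fun h x h1 h2 => h x ⟨h1, h2⟩, fun h x hx => h x hx.1 hx.2⟩

lemma interDim_chart_eq_zero {K : Finset (Fin n)} {S : Matrix (Fin n) (Fin n) ℝ}
    (h : ∀ y : Fin n → ℝ, (∀ i ∉ K, y i = 0) → (∀ i ∈ K, S.mulVec y i = 0) → y = 0) :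
    interDim (chart K S) = 0 := by
  rw [interDim_eq_zero_iff]
  intro x hx hσ
  obtain ⟨h1, h2⟩ := (mem_sigma_iff_coord K).1 hσ
  have hx' := mem_chart.1 hx
  have h0 : baseCoord K x = 0 := h _ h1 fun i hi => by rw [← hx']; exact h2 i hi
  exact eq_zero_of_coord K h0 (by rw [hx', h0, Matrix.mulVec_zero])

/-- The quadratic form of `S` is positive on vectors supported in `K`. -/
def PosOn (K : Finset (Fin n)) (S : Matrix (Fin n) (Fin n) ℝ) : Prop :=
  ∀ y : Fin n → ℝ, (∀ i ∉ K, y i = 0) → y ≠ 0 → 0 < y ⬝ᵥ S.mulVec y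

/-- A definite `K`-block is nondegenerate: a kernel vector `y` would satisfy `y ⬝ᵥ S y = 0`. -/
lemma interDim_chart_of_posOn {K : Finset (Fin n)} {S : Matrix (Fin n) (Fin n) ℝ}
    (h : PosOn K S ∨ PosOn K (-S)) : interDim (chart K S) = 0 := by
  refine interDim_chart_eq_zero fun y hy hSy => ?_
  by_contra hne
  have h0 : y ⬝ᵥ S.mulVec y = 0 := Finset.sum_eq_zero fun i _ => by
    by_cases hi : i ∈ K
    · rw [hSy i hi, mul_zero]
    · rw [hy i hi, zero_mul]
  rcases h with h | h
  · exact (h y hy hne).ne' h0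
  · have := h y hy hne
    rw [Matrix.neg_mulVec, dotProduct_neg, h0] at this
    simp at this

lemma interDim_chart_singleton_eq_zero {κ : Fin n} {S : Matrix (Fin n) (Fin n) ℝ}
    (h : S κ κ ≠ 0) : interDim (chart {κ} S) = 0 := by
  refine interDim_chart_eq_zero fun y hy hSy => ?_
  have hy' : y = Pi.single κ (y κ) := by
    ext i
    by_cases hi : i = κ
    · subst hi; simp
    · rw [hy i (by simpa using hi)]; simp [hi]
  have := hSy κ (by simp)
  rw [hy', Matrix.mulVec_single] at this
  have h0 : y κ = 0 := by simpa [h] using this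
  rw [hy', h0, Pi.single_zero]

lemma interDim_chart_singleton_eq_one {κ : Fin n} {S : Matrix (Fin n) (Fin n) ℝ}
    (h : S κ κ = 0) : interDim (chart {κ} S) = 1 := by
  have hne : ofCoord {κ} (Pi.single κ 1) (S.mulVec (Pi.single κ 1)) ≠ 0 := by
    intro h0
    have := congrArg (fun x => baseCoord {κ} x κ) h0
    simp at this
  suffices h' : chart {κ} S ⊓ sigma n =
      Submodule.span ℝ {ofCoord {κ} (Pi.single κ 1) (S.mulVec (Pi.single κ 1))} by
    rw [interDim, h', finrank_span_singleton hne]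
  refine le_antisymm (fun x hx => ?_) ?_
  · obtain ⟨h1, h2⟩ := (mem_sigma_iff_coord {κ}).1 hx.2
    have hb : baseCoord {κ} x = baseCoord {κ} x κ • Pi.single κ 1 := by
      ext i
      by_cases hi : i = κ
      · subst hi; simp
      · rw [h1 i (by simpa using hi)]; simp [hi]
    rw [Submodule.mem_span_singleton]
    refine ⟨baseCoord {κ} x κ, ?_⟩
    rw [← sub_eq_zero]
    refine eq_zero_of_coord {κ} ?_ ?_
    · rw [map_sub, map_smul, baseCoord_ofCoord, ← hb, sub_self]
    · rw [map_sub, map_smul, fibreCoord_ofCoord, mem_chart.1 hx.1, ← Matrix.mulVec_smul, ← hb,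
        sub_self]
  · rw [Submodule.span_singleton_le_iff_mem]
    refine ⟨mem_chart.2 (by simp), (mem_sigma_iff_coord {κ}).2 ⟨?_, ?_⟩⟩
    · intro i hi
      simp only [baseCoord_ofCoord]
      rw [Pi.single_eq_of_ne (by simpa using hi)]
    · intro i hi
      rw [Finset.mem_singleton] at hi
      subst hi
      simpa using h

/-- For diagonal matrices the Lagrangian splits into lines in the planes `(q i, p i)`; undoing the
quarter turn in one plane replaces the slope `d` by `-d⁻¹`. -/
lemma chart_diagonal_eq {K K' : Finset (Fin n)} (hK : K' ⊆ K) {d : Fin n → ℝ}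
    (hd : ∀ i ∈ K, i ∉ K' → d i ≠ 0) :
    chart K (Matrix.diagonal d) =
      chart K' (Matrix.diagonal fun i => if i ∈ K ∧ i ∉ K' then -(d i)⁻¹ else d i) := by
  ext x
  rw [mem_chart, mem_chart, funext_iff, funext_iff]
  refine forall_congr' fun i => ?_
  rw [Matrix.mulVec_diagonal, Matrix.mulVec_diagonal]
  simp only [fibreCoord_apply, baseCoord_apply]
  by_cases h1 : i ∈ K
  · by_cases h2 : i ∈ K'
    · simp [h1, h2]
    · have := hd i h1 h2
      simp only [h1, h2, if_true, if_false, not_false_eq_true, and_self]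
      constructor
      · intro h
        field_simp
        linarith
      · intro h
        rw [h]
        field_simp
  · have h2 : i ∉ K' := fun h => h1 (hK h)
    simp [h1, h2]

/-- A graph chart is the set of Lagrangians transversal to `σ`. -/
lemma exists_chart_empty {L : Submodule ℝ (PhaseSpace n)} (hL : IsLagrangian L)
    (h : interDim L = 0) : ∃ S : Matrix (Fin n) (Fin n) ℝ, S.IsSymm ∧ L = chart ∅ S := by
  refine exists_chart_of_injective hL fun x hx hx0 => interDim_eq_zero_iff.1 h x hx fun i => ?_
  simpa [baseCoord_apply] using congrFun hx0 i

/-! ### The topology of the Lagrangian Grassmannian in terms of matrices -/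

/-- The matrix of the orthogonal projection onto `L`. -/
def projMatrix (L : Submodule ℝ (PhaseSpace n)) : Matrix (Fin n ⊕ Fin n) (Fin n ⊕ Fin n) ℝ :=
  (Matrix.toEuclideanCLM (n := Fin n ⊕ Fin n) (𝕜 := ℝ)).symm L.starProjection

lemma toEuclideanCLM_projMatrix (L : Submodule ℝ (PhaseSpace n)) :
    Matrix.toEuclideanCLM (n := Fin n ⊕ Fin n) (𝕜 := ℝ) (projMatrix L) = L.starProjection :=
  StarAlgEquiv.apply_symm_apply _ _

lemma projMatrix_mulVec (L : Submodule ℝ (PhaseSpace n)) (x : PhaseSpace n) :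
    (projMatrix L).mulVec x = L.starProjection x := by
  rw [← toEuclideanCLM_projMatrix, Matrix.ofLp_toEuclideanCLM]

lemma projMatrix_apply (L : Submodule ℝ (PhaseSpace n)) (i j : Fin n ⊕ Fin n) :
    projMatrix L i j = L.starProjection (EuclideanSpace.single j 1) i := by
  rw [← projMatrix_mulVec]
  simp

lemma continuous_projMatrix :
    Continuous fun L : LagrangianGrassmannian n => projMatrix L.1 := by
  refine continuous_matrix fun i j => ?_
  simp_rw [projMatrix_apply]
  have h : Continuous fun L : LagrangianGrassmannian n => L.1.starProjection :=
    continuous_induced_dom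
  have h2 := h.clm_apply (continuous_const (y := EuclideanSpace.single j (1 : ℝ)))
  exact (EuclideanSpace.proj (𝕜 := ℝ) i).continuous.comp h2

lemma continuous_of_projMatrix {T : Type*} [TopologicalSpace T] {F : T → LagrangianGrassmannian n}
    (h : Continuous fun t => projMatrix (F t).1) : Continuous F := by
  refine continuous_induced_rng.2 ?_
  have h2 : Continuous (Matrix.toEuclideanCLM (n := Fin n ⊕ Fin n) (𝕜 := ℝ)) :=
    LinearMap.continuous_of_finiteDimensional
      ((Matrix.toEuclideanCLM (n := Fin n ⊕ Fin n) (𝕜 := ℝ)).toAlgEquiv.toLinearMap)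
  have h3 := h2.comp h
  refine h3.congr fun t => ?_
  exact toEuclideanCLM_projMatrix _

/-- The columns of `Z` form a basis of `L`. -/
def IsFrame (L : Submodule ℝ (PhaseSpace n)) (Z : Matrix (Fin n ⊕ Fin n) (Fin n) ℝ) : Prop :=
  (∀ x : PhaseSpace n, x ∈ L ↔ ∃ c : Fin n → ℝ, Z.mulVec c = x) ∧
    ∀ c : Fin n → ℝ, Z.mulVec c = 0 → c = 0

lemma IsFrame.det_ne_zero {L : Submodule ℝ (PhaseSpace n)}
    {Z : Matrix (Fin n ⊕ Fin n) (Fin n) ℝ} (h : IsFrame L Z) : (Z.transpose * Z).det ≠ 0 := by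
  intro h0
  obtain ⟨c, hc, hc0⟩ := Matrix.exists_mulVec_eq_zero_iff.2 h0
  have : c ∈ LinearMap.ker (Z.transpose * Z).mulVecLin := hc0
  rw [Matrix.ker_mulVecLin_transpose_mul_self] at this
  exact hc (h.2 c this)

/-- These are the normal equations: the residual is orthogonal to the columns of `Z`. The formula is
continuous in `Z`, so a continuous family of frames spans a continuous curve in `Λ(n)`. -/
lemma IsFrame.projMatrix_eq {L : Submodule ℝ (PhaseSpace n)}
    {Z : Matrix (Fin n ⊕ Fin n) (Fin n) ℝ} (h : IsFrame L Z) :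
    projMatrix L = Z * (Z.transpose * Z)⁻¹ * Z.transpose := by
  have hu : IsUnit (Z.transpose * Z).det := isUnit_iff_ne_zero.2 h.det_ne_zero
  rw [projMatrix, StarAlgEquiv.symm_apply_eq]
  ext1 x
  refine Submodule.eq_starProjection_of_mem_of_inner_eq_zero ?_ fun w hw => ?_
  · rw [h.1]
    exact ⟨((Z.transpose * Z)⁻¹ * Z.transpose).mulVec x, by
      rw [Matrix.ofLp_toEuclideanCLM, Matrix.mulVec_mulVec, Matrix.mul_assoc]⟩
  · obtain ⟨c, hc⟩ := (h.1 w).1 hw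
    have : inner ℝ (x - Matrix.toEuclideanCLM (𝕜 := ℝ)
        (Z * (Z.transpose * Z)⁻¹ * Z.transpose) x) w =
        (x.ofLp - (Z * (Z.transpose * Z)⁻¹ * Z.transpose).mulVec x) ⬝ᵥ w.ofLp := by
      rw [PiLp.inner_apply]
      refine Finset.sum_congr rfl fun i _ => ?_
      simp [mul_comm]
    rw [this, ← hc, Matrix.dotProduct_mulVec, ← Matrix.mulVec_transpose, Matrix.mulVec_sub,
      Matrix.mulVec_mulVec, ← Matrix.mul_assoc, ← Matrix.mul_assoc, Matrix.mul_nonsing_inv _ hu,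
      Matrix.one_mul, sub_self, zero_dotProduct]

lemma continuousAt_inv_of_det_ne_zero {ι : Type*} [Fintype ι] [DecidableEq ι]
    {M : Matrix ι ι ℝ} (h : M.det ≠ 0) : ContinuousAt (fun M : Matrix ι ι ℝ => M⁻¹) M := by
  refine continuousAt_matrix_inv _ ?_
  simp only [Ring.inverse_eq_inv']
  exact continuousAt_inv₀ h

lemma continuous_of_isFrame {T : Type*} [TopologicalSpace T] {F : T → LagrangianGrassmannian n}
    {Z : T → Matrix (Fin n ⊕ Fin n) (Fin n) ℝ} (hZ : Continuous Z)
    (h : ∀ t, IsFrame (F t).1 (Z t)) : Continuous F := by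
  refine continuous_of_projMatrix ?_
  simp_rw [fun t => (h t).projMatrix_eq]
  have h1 : Continuous fun t => ((Z t).transpose * Z t) := hZ.matrix_transpose.matrix_mul hZ
  have h2 : Continuous fun t => ((Z t).transpose * Z t)⁻¹ := continuous_iff_continuousAt.2 fun t =>
    ContinuousAt.comp (f := fun t => (Z t).transpose * Z t)
      (continuousAt_inv_of_det_ne_zero (h t).det_ne_zero) h1.continuousAt
  exact (hZ.matrix_mul h2).matrix_mul hZ.matrix_transpose

/-- The frame of `φ_K(S)` obtained from the standard basis of `ℝⁿ`. -/
def chartFrame (K : Finset (Fin n)) (S : Matrix (Fin n) (Fin n) ℝ) :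
    Matrix (Fin n ⊕ Fin n) (Fin n) ℝ :=
  Matrix.of (Sum.elim (fun i j => if i ∈ K then -S i j else (1 : Matrix (Fin n) (Fin n) ℝ) i j)
    (fun i j => if i ∈ K then (1 : Matrix (Fin n) (Fin n) ℝ) i j else S i j))

lemma chartFrame_mulVec (K : Finset (Fin n)) (S : Matrix (Fin n) (Fin n) ℝ) (c : Fin n → ℝ) :
    (chartFrame K S).mulVec c = ofCoord K c (S.mulVec c) := by
  have h1 : ∀ i, ∑ j, (1 : Matrix (Fin n) (Fin n) ℝ) i j * c j = c i := fun i =>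
    congrFun (Matrix.one_mulVec c) i
  ext i
  rcases i with i | i <;> by_cases h : i ∈ K <;>
    simp [chartFrame, Matrix.mulVec, dotProduct, ofCoord, h, h1]

lemma isFrame_chartFrame (K : Finset (Fin n)) (S : Matrix (Fin n) (Fin n) ℝ) :
    IsFrame (chart K S) (chartFrame K S) := by
  refine ⟨fun x => ?_, fun c hc => ?_⟩
  · constructor
    · intro hx
      refine ⟨baseCoord K x, ?_⟩
      rw [chartFrame_mulVec, ← mem_chart.1 hx, ofCoord_coord]
    · rintro ⟨c, hc⟩
      rw [chartFrame_mulVec] at hc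
      have : ofCoord K c (S.mulVec c) = x := WithLp.ofLp_injective 2 hc
      rw [← this, mem_chart]
      simp
  · rw [chartFrame_mulVec] at hc
    have : ofCoord K c (S.mulVec c) = 0 := WithLp.ofLp_injective 2 hc
    simpa using congrArg (baseCoord K) this

/-- The symmetric part of a matrix. -/
def symmPart (S : Matrix (Fin n) (Fin n) ℝ) : Matrix (Fin n) (Fin n) ℝ :=
  (1 / 2 : ℝ) • (S + S.transpose)

lemma isSymm_symmPart (S : Matrix (Fin n) (Fin n) ℝ) : (symmPart S).IsSymm := by
  simp [Matrix.IsSymm, symmPart, Matrix.transpose_add, add_comm]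

lemma symmPart_eq_self {S : Matrix (Fin n) (Fin n) ℝ} (hS : S.IsSymm) : symmPart S = S := by
  rw [symmPart, hS.eq, ← two_smul ℝ S, smul_smul]
  norm_num

lemma continuous_symmPart :
    Continuous (symmPart : Matrix (Fin n) (Fin n) ℝ → Matrix (Fin n) (Fin n) ℝ) :=
  (continuous_id.add continuous_id.matrix_transpose).const_smul (1 / 2 : ℝ)

/-- The chart `φ_K` as a map to the Lagrangian Grassmannian, extended to all matrices by
symmetrization. -/
def chartPoint (K : Finset (Fin n)) (S : Matrix (Fin n) (Fin n) ℝ) : LagrangianGrassmannian n :=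
  ⟨chart K (symmPart S), isLagrangian_chart K (isSymm_symmPart S)⟩

lemma chartPoint_val (K : Finset (Fin n)) {S : Matrix (Fin n) (Fin n) ℝ} (hS : S.IsSymm) :
    (chartPoint K S).1 = chart K S := by
  change chart K (symmPart S) = _
  rw [symmPart_eq_self hS]

lemma continuous_chartPoint (K : Finset (Fin n)) :
    Continuous (chartPoint K : Matrix (Fin n) (Fin n) ℝ → LagrangianGrassmannian n) := by
  refine continuous_of_isFrame (Z := fun S => chartFrame K (symmPart S)) ?_
    fun S => isFrame_chartFrame K _
  refine continuous_matrix fun i j => ?_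
  have h : ∀ i j, Continuous fun S : Matrix (Fin n) (Fin n) ℝ => symmPart S i j := fun i j =>
    continuous_symmPart.matrix_elem i j
  rcases i with i | i <;> by_cases hi : i ∈ K <;>
    simp only [chartFrame, Matrix.of_apply, Sum.elim_inl, Sum.elim_inr, hi, if_true, if_false]
  exacts [(h i j).neg, continuous_const, continuous_const, h i j]

/-! ### Projections onto Lagrangians -/

/-- Multiplication by the imaginary unit maps a Lagrangian onto its orthogonal complement. -/
lemma starProjection_rotation {L : Submodule ℝ (PhaseSpace n)} (hL : IsLagrangian L)
    (x : PhaseSpace n) :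
    L.starProjection (rotation Finset.univ x) =
      rotation Finset.univ x - rotation Finset.univ (L.starProjection x) := by
  set J : PhaseSpace n →ₗ[ℝ] PhaseSpace n := rotation Finset.univ with hJ
  have hJJ : ∀ x, J (J x) = -x := fun x => by
    ext i
    rcases i with i | i <;> simp [hJ, rotation]
  have hinner : ∀ x y, inner ℝ (J x) y = omega y x := fun x y => by
    rw [PiLp.inner_apply, Fintype.sum_sum_type, omega, ← Finset.sum_add_distrib]
    refine Finset.sum_congr rfl fun i _ => ?_
    simp [hJ, rotation]
  have hperp : L.map J ≤ Lᗮ := by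
    rintro _ ⟨x, hx, rfl⟩
    rw [Submodule.mem_orthogonal']
    intro u hu
    rw [hinner, hL.1 u hu x hx]
  have hJinj : Function.Injective J := fun x y h => by
    have := congrArg J h
    rwa [hJJ, hJJ, neg_inj] at this
  have heq : L.map J = Lᗮ := by
    refine Submodule.eq_of_le_of_finrank_eq hperp ?_
    have h1 := L.finrank_add_finrank_orthogonal
    have h2 := LinearMap.finrank_range_of_inj (f := J.domRestrict L) (hJinj.comp Subtype.val_injective)
    rw [LinearMap.range_domRestrict] at h2
    rw [h2]
    rw [hL.2] at h1 ⊢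
    simp at h1
    omega
  -- With `P` the projection, `P J P = 0` because `J L = Lᗮ`, and `P J (1 - P) = J (1 - P)` because
  -- `J Lᗮ = L`; together they give `P J = J - J P`.
  have hP1 : L.starProjection (J (L.starProjection x)) = 0 := by
    rw [Submodule.starProjection_apply_eq_zero_iff]
    exact hperp ⟨_, Submodule.starProjection_apply_mem _ _, rfl⟩
  have hP2 : L.starProjection (J (x - L.starProjection x)) = J (x - L.starProjection x) := by
    rw [Submodule.starProjection_eq_self_iff]
    have : x - L.starProjection x ∈ L.map J := heq ▸ L.sub_starProjection_mem_orthogonal x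
    obtain ⟨y, hy, hxy⟩ := this
    rw [← hxy, hJJ]
    exact L.neg_mem hy
  rw [map_sub, map_sub, hP1, sub_zero] at hP2
  exact hP2

/-- The block of the projection matrix describing the `q`-component of the image of `q`. -/
def projBase (L : Submodule ℝ (PhaseSpace n)) : Matrix (Fin n) (Fin n) ℝ :=
  (projMatrix L).toBlocks₁₁

/-- The block of the projection matrix describing the `p`-component of the image of `q`. -/
def projCross (L : Submodule ℝ (PhaseSpace n)) : Matrix (Fin n) (Fin n) ℝ :=
  (projMatrix L).toBlocks₂₁

/-- Since `J` maps the `q`-basis to the `p`-basis, `P J = J - J P` expresses the second block column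
of `P` through the first. -/
lemma projMatrix_eq_fromBlocks {L : Submodule ℝ (PhaseSpace n)} (hL : IsLagrangian L) :
    projMatrix L = Matrix.fromBlocks (projBase L) (projCross L) (projCross L) (1 - projBase L) := by
  have key : ∀ j : Fin n, ∀ i,
      projMatrix L i (Sum.inr j) = (if i = Sum.inr j then 1 else 0) -
        Sum.elim (fun k => -projMatrix L (Sum.inr k) (Sum.inl j))
          (fun k => projMatrix L (Sum.inl k) (Sum.inl j)) i := by
    intro j i
    have h := starProjection_rotation hL (EuclideanSpace.single (Sum.inl j) 1)
    have hr : rotation Finset.univ (EuclideanSpace.single (Sum.inl j) (1 : ℝ)) =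
        EuclideanSpace.single (Sum.inr j : Fin n ⊕ Fin n) (1 : ℝ) := by
      ext k
      rcases k with k | k <;> simp [rotation]
    rw [hr] at h
    rw [projMatrix_apply, h]
    rcases i with i | i <;> simp [rotation, projMatrix_apply]
  ext i j
  rcases i with i | i <;> rcases j with j | j
  · rfl
  · simp [key, projCross, Matrix.toBlocks₂₁]
  · rfl
  · simp [key, projBase, Matrix.toBlocks₁₁, Matrix.one_apply]

/-- This identity and `projCross_mulVec_sub` are the two block rows of `P x = x`. -/
lemma projBase_mulVec_add {L : Submodule ℝ (PhaseSpace n)} (hL : IsLagrangian L)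
    {x : PhaseSpace n} (hx : x ∈ L) :
    (projBase L).mulVec (fun i => x (Sum.inl i)) + (projCross L).mulVec (fun i => x (Sum.inr i)) =
      fun i => x (Sum.inl i) := by
  have h := projMatrix_mulVec L x
  rw [Submodule.starProjection_eq_self_iff.2 hx, projMatrix_eq_fromBlocks hL,
    Matrix.fromBlocks_mulVec] at h
  ext i
  exact congrFun h (Sum.inl i)

lemma projCross_mulVec_sub {L : Submodule ℝ (PhaseSpace n)} (hL : IsLagrangian L)
    {x : PhaseSpace n} (hx : x ∈ L) :
    (projCross L).mulVec (fun i => x (Sum.inl i)) =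
      (projBase L).mulVec (fun i => x (Sum.inr i)) := by
  have h := projMatrix_mulVec L x
  rw [Submodule.starProjection_eq_self_iff.2 hx, projMatrix_eq_fromBlocks hL,
    Matrix.fromBlocks_mulVec, Matrix.sub_mulVec, Matrix.one_mulVec] at h
  ext i
  have := congrFun h (Sum.inr i)
  simp only [Sum.elim_inr, Pi.add_apply, Pi.sub_apply, Function.comp_def] at this
  linarith

lemma chart_empty_mem (S : Matrix (Fin n) (Fin n) ℝ) (u : Fin n → ℝ) :
    (WithLp.toLp 2 (Sum.elim u (S.mulVec u)) : PhaseSpace n) ∈ chart ∅ S := by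
  rw [mem_chart]
  have h1 : fibreCoord ∅ (WithLp.toLp 2 (Sum.elim u (S.mulVec u)) : PhaseSpace n) = S.mulVec u := by
    ext i; simp [fibreCoord_apply]
  have h2 : baseCoord ∅ (WithLp.toLp 2 (Sum.elim u (S.mulVec u)) : PhaseSpace n) = u := by
    ext i; simp [baseCoord_apply]
  rw [h1, h2]

/-- On the points `(u, S u)` the second block row gives the formula for `projCross`; inserting it
into the first gives the inverse of `1 + S²`. -/
lemma projBase_mul_eq_one {S : Matrix (Fin n) (Fin n) ℝ} (hS : S.IsSymm) :
    projBase (chart ∅ S) * (1 + S * S) = 1 ∧ projCross (chart ∅ S) = projBase (chart ∅ S) * S := by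
  have hL := isLagrangian_chart ∅ hS
  have h2 : projCross (chart ∅ S) = projBase (chart ∅ S) * S := by
    refine Matrix.ext_of_mulVec_single fun i => ?_
    rw [← Matrix.mulVec_mulVec]
    exact projCross_mulVec_sub hL (chart_empty_mem S (Pi.single i 1))
  refine ⟨?_, h2⟩
  refine Matrix.ext_of_mulVec_single fun i => ?_
  have := projBase_mulVec_add hL (chart_empty_mem S (Pi.single i 1))
  simp only [Sum.elim_inl, Sum.elim_inr] at this
  rw [h2] at this
  rw [mul_add, mul_one, Matrix.add_mulVec, Matrix.one_mulVec, ← Matrix.mul_assoc,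
    ← Matrix.mulVec_mulVec]
  exact this

/-- For a graph, `projBase` is the inverse of `1 + S²`; in general the momentum of any vector in `L
∩ σ` lies in the kernel of `projBase`. This makes `Λ⁰(σ)` open and `graphMatrix` continuous on it.
-/
lemma det_projBase_ne_zero_iff {L : Submodule ℝ (PhaseSpace n)} (hL : IsLagrangian L) :
    (projBase L).det ≠ 0 ↔ interDim L = 0 := by
  constructor
  · intro hdet
    rw [interDim_eq_zero_iff]
    intro x hx hσ
    have hσ' : (fun i => x (Sum.inl i)) = (0 : Fin n → ℝ) := funext hσ
    have h := projCross_mulVec_sub hL hx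
    rw [hσ', Matrix.mulVec_zero] at h
    have h0 : (fun i => x (Sum.inr i)) = (0 : Fin n → ℝ) := by
      by_contra hne
      exact hdet (Matrix.exists_mulVec_eq_zero_iff.1 ⟨_, hne, h.symm⟩)
    ext i
    rcases i with i | i
    · exact hσ i
    · exact congrFun h0 i
  · intro h
    obtain ⟨S, hS, rfl⟩ := exists_chart_empty hL h
    have := congrArg Matrix.det (projBase_mul_eq_one hS).1
    rw [Matrix.det_mul, Matrix.det_one] at this
    exact left_ne_zero_of_mul_eq_one this

/-- The matrix `S` such that `L = λ_S`, for `L` transversal to `σ`. -/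
def graphMatrix (L : LagrangianGrassmannian n) : Matrix (Fin n) (Fin n) ℝ :=
  (projBase L.1)⁻¹ * projCross L.1

lemma graphMatrix_eq {L : LagrangianGrassmannian n} {S : Matrix (Fin n) (Fin n) ℝ} (hS : S.IsSymm)
    (h : L.1 = chart ∅ S) : graphMatrix L = S := by
  obtain ⟨h1, h2⟩ := projBase_mul_eq_one hS
  have hu : IsUnit (projBase (chart ∅ S)).det := by
    have := congrArg Matrix.det h1
    rw [Matrix.det_mul, Matrix.det_one] at this
    exact IsUnit.of_mul_eq_one _ this
  rw [graphMatrix, h, h2, ← Matrix.mul_assoc, Matrix.nonsing_inv_mul _ hu, Matrix.one_mul]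

lemma chart_graphMatrix {L : LagrangianGrassmannian n} (h : interDim L.1 = 0) :
    (graphMatrix L).IsSymm ∧ L.1 = chart ∅ (graphMatrix L) := by
  obtain ⟨S, hS, hLS⟩ := exists_chart_empty L.2 h
  rw [graphMatrix_eq hS hLS]
  exact ⟨hS, hLS⟩

lemma continuous_projBase : Continuous fun L : LagrangianGrassmannian n => projBase L.1 :=
  continuous_matrix fun i j => continuous_projMatrix.matrix_elem (Sum.inl i) (Sum.inl j)

lemma continuous_projCross : Continuous fun L : LagrangianGrassmannian n => projCross L.1 :=
  continuous_matrix fun i j => continuous_projMatrix.matrix_elem (Sum.inr i) (Sum.inl j)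

lemma continuousAt_graphMatrix {L : LagrangianGrassmannian n} (h : interDim L.1 = 0) :
    ContinuousAt graphMatrix L := by
  have h1 : ContinuousAt (fun L : LagrangianGrassmannian n => (projBase L.1)⁻¹) L :=
    ContinuousAt.comp (f := fun L : LagrangianGrassmannian n => projBase L.1)
      (continuousAt_inv_of_det_ne_zero ((det_projBase_ne_zero_iff L.2).2 h))
      continuous_projBase.continuousAt
  have h2 : Continuous fun p : Matrix (Fin n) (Fin n) ℝ × Matrix (Fin n) (Fin n) ℝ => p.1 * p.2 :=
    continuous_fst.matrix_mul continuous_snd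
  exact ContinuousAt.comp (f := fun L : LagrangianGrassmannian n =>
    ((projBase L.1)⁻¹, projCross L.1)) h2.continuousAt (h1.prodMk continuous_projCross.continuousAt)

lemma isOpen_interDim_eq_zero : IsOpen {L : LagrangianGrassmannian n | interDim L.1 = 0} := by
  have : {L : LagrangianGrassmannian n | interDim L.1 = 0} =
      (fun L : LagrangianGrassmannian n => (projBase L.1).det) ⁻¹' {0}ᶜ := by
    ext L
    simp [← det_projBase_ne_zero_iff L.2]
  rw [this]
  exact isOpen_compl_singleton.preimage continuous_projBase.matrix_det

lemma mem_maslovCycle {L : LagrangianGrassmannian n} : L ∈ maslovCycle n ↔ interDim L.1 ≠ 0 := by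
  simp [maslovCycle, stratum, Nat.one_le_iff_ne_zero]

/-! ### The determinant map to `ℂ \ {0}` and its logarithms -/

/-- The complex coordinates `q + ip`. -/
def complexCoord (x : PhaseSpace n) : Fin n → ℂ :=
  fun i => x (Sum.inl i) + Complex.I * x (Sum.inr i)

/-- The unitary matrix `W` for which the reflection in `L` is `z ↦ W z̄`. -/
def souriau (L : Submodule ℝ (PhaseSpace n)) : Matrix (Fin n) (Fin n) ℂ :=
  Matrix.of fun i j => (((2 * projBase L i j - (1 : Matrix (Fin n) (Fin n) ℝ) i j : ℝ) : ℂ) +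
    Complex.I * ((2 * projCross L i j : ℝ) : ℂ))

/-- Points of `L` are fixed by the reflection `2P - 1`; the real and imaginary parts are the two
block rows of `P x = x`. -/
lemma souriau_mulVec {L : Submodule ℝ (PhaseSpace n)} (hL : IsLagrangian L)
    {x : PhaseSpace n} (hx : x ∈ L) :
    (souriau L).mulVec (fun i => (starRingEnd ℂ) (complexCoord x i)) = complexCoord x := by
  have h1 : ∀ u : Fin n → ℝ, ∀ i, ∑ j, (1 : Matrix (Fin n) (Fin n) ℝ) i j * u j = u i := fun u i =>
    congrFun (Matrix.one_mulVec u) i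
  ext i
  have hre := congrFun (projBase_mulVec_add hL hx) i
  have him := congrFun (projCross_mulVec_sub hL hx) i
  simp only [Matrix.mulVec, dotProduct, Pi.add_apply] at hre him
  rw [Matrix.mulVec, dotProduct]
  apply Complex.ext
  · rw [Complex.re_sum]
    simp only [souriau, complexCoord, Matrix.of_apply]
    simp only [map_add, map_mul, Complex.conj_ofReal, Complex.conj_I, Complex.mul_re,
      Complex.add_re, Complex.add_im, Complex.mul_im, Complex.ofReal_re, Complex.ofReal_im,
      Complex.I_re, Complex.I_im, Complex.neg_re, Complex.neg_im]
    have h2 : ∑ j, ((2 * projBase L i j - (1 : Matrix (Fin n) (Fin n) ℝ) i j) * x (Sum.inl j) +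
        2 * projCross L i j * x (Sum.inr j)) = 2 * ∑ j, projBase L i j * x (Sum.inl j) +
          2 * ∑ j, projCross L i j * x (Sum.inr j) - x (Sum.inl i) := by
      rw [← h1 (fun j => x (Sum.inl j)) i, Finset.mul_sum, Finset.mul_sum,
        ← Finset.sum_add_distrib, ← Finset.sum_sub_distrib]
      exact Finset.sum_congr rfl fun j _ => by ring
    refine Eq.trans (Finset.sum_congr rfl fun j _ => ?_) (h2.trans ?_)
    · ring
    · linarith
  · rw [Complex.im_sum]
    simp only [souriau, complexCoord, Matrix.of_apply]
    simp only [map_add, map_mul, Complex.conj_ofReal, Complex.conj_I, Complex.mul_re,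
      Complex.add_re, Complex.add_im, Complex.mul_im, Complex.ofReal_re, Complex.ofReal_im,
      Complex.I_re, Complex.I_im, Complex.neg_re, Complex.neg_im]
    have h2 : ∑ j, (2 * projCross L i j * x (Sum.inl j) -
        (2 * projBase L i j - (1 : Matrix (Fin n) (Fin n) ℝ) i j) * x (Sum.inr j)) =
          2 * ∑ j, projCross L i j * x (Sum.inl j) - 2 * ∑ j, projBase L i j * x (Sum.inr j) +
          x (Sum.inr i) := by
      rw [← h1 (fun j => x (Sum.inr j)) i, Finset.mul_sum, Finset.mul_sum,
        ← Finset.sum_sub_distrib, ← Finset.sum_add_distrib]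
      exact Finset.sum_congr rfl fun j _ => by ring
    refine Eq.trans (Finset.sum_congr rfl fun j _ => ?_) (h2.trans ?_)
    · ring
    · linarith

/-- `det (1 + iS)`. -/
def cayleyDet (S : Matrix (Fin n) (Fin n) ℝ) : ℂ :=
  (1 + Complex.I • S.map Complex.ofReal).det

lemma conj_cayleyDet (S : Matrix (Fin n) (Fin n) ℝ) :
    (starRingEnd ℂ) (cayleyDet S) = (1 - Complex.I • S.map Complex.ofReal).det := by
  rw [cayleyDet, RingHom.map_det]
  congr 1
  ext i j
  by_cases h : i = j <;> simp [h, sub_eq_add_neg]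

/-- `|det (1 + iS)|² = det (1 + S²)`, and `1 + S²` is invertible by `projBase_mul_eq_one`. -/
lemma cayleyDet_ne_zero {S : Matrix (Fin n) (Fin n) ℝ} (hS : S.IsSymm) : cayleyDet S ≠ 0 := by
  have h1 : (1 + S * S).det ≠ 0 := by
    have := congrArg Matrix.det (projBase_mul_eq_one hS).1
    rw [Matrix.det_mul, Matrix.det_one] at this
    exact right_ne_zero_of_mul_eq_one this
  have h2 : cayleyDet S * (starRingEnd ℂ) (cayleyDet S) = ((1 + S * S).det : ℝ) := by
    rw [conj_cayleyDet, cayleyDet, ← Matrix.det_mul]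
    have h3 : (1 + Complex.I • S.map Complex.ofReal) * (1 - Complex.I • S.map Complex.ofReal) =
        Complex.ofRealHom.mapMatrix (1 + S * S) := by
      rw [map_add, map_one, map_mul]
      have : Complex.ofRealHom.mapMatrix S = S.map Complex.ofReal := rfl
      have hX : ∀ X : Matrix (Fin n) (Fin n) ℂ, (1 + X) * (1 - X) = 1 - X * X := fun X => by
        noncomm_ring
      rw [this, hX, smul_mul_smul_comm, Complex.I_mul_I, neg_smul, one_smul, sub_neg_eq_add]
    rw [h3, ← RingHom.map_det]
    rfl
  intro h0
  rw [h0, zero_mul] at h2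
  exact h1 (by exact_mod_cast h2.symm)

/-- The columns of `Z` are a frame of the Lagrangian in complex coordinates, so `W Z̄ = Z` and `det
W` is the quotient of `det Z` by its conjugate. Each index in `K` contributes `i / (-i) = -1`. -/
lemma det_souriau_chart (K : Finset (Fin n)) {S : Matrix (Fin n) (Fin n) ℝ} (hS : S.IsSymm) :
    (souriau (chart K S)).det =
      (-1) ^ K.card * (cayleyDet S / (starRingEnd ℂ) (cayleyDet S)) := by
  set Z : Matrix (Fin n) (Fin n) ℂ :=
    Matrix.diagonal (fun i => if i ∈ K then Complex.I else 1) *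
      (1 + Complex.I • S.map Complex.ofReal) with hZ
  have hcol : ∀ j, (fun i => Z i j) = complexCoord (ofCoord K (Pi.single j 1) (S.mulVec (Pi.single j 1))) := by
    intro j
    ext i
    have h1 : (1 : Matrix (Fin n) (Fin n) ℂ) i j =
        ((Pi.single j 1 : Fin n → ℝ) i : ℂ) := by
      by_cases h : i = j <;> simp [Matrix.one_apply, h]
    by_cases h : i ∈ K
    · rw [hZ, Matrix.diagonal_mul, Matrix.add_apply, h1]
      simp [complexCoord, ofCoord, h, mul_add, ← mul_assoc, add_comm]
    · rw [hZ, Matrix.diagonal_mul, Matrix.add_apply, h1]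
      simp [complexCoord, ofCoord, h]
  have hW : souriau (chart K S) * (starRingEnd ℂ).mapMatrix Z = Z := by
    ext i j
    have := congrFun (souriau_mulVec (isLagrangian_chart K hS)
      (mem_chart.2 (by simp) : ofCoord K (Pi.single j 1) (S.mulVec (Pi.single j 1)) ∈ chart K S)) i
    rw [← hcol] at this
    exact this
  have hdet : Z.det = Complex.I ^ K.card * cayleyDet S := by
    rw [hZ, Matrix.det_mul, Matrix.det_diagonal, cayleyDet, Finset.prod_ite]
    simp
  have h := congrArg Matrix.det hW
  rw [Matrix.det_mul, ← RingHom.map_det, hdet, map_mul, map_pow, Complex.conj_I] at h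
  have hD := cayleyDet_ne_zero hS
  have hD' : (starRingEnd ℂ) (cayleyDet S) ≠ 0 := by simpa using hD
  have hI : (-Complex.I) ^ K.card ≠ 0 := pow_ne_zero _ (by simp)
  have hII : (-1 : ℂ) ^ K.card * (-Complex.I) ^ K.card = Complex.I ^ K.card := by
    rw [← mul_pow]; simp
  field_simp
  refine mul_right_cancel₀ hI ?_
  linear_combination h - cayleyDet S * hII

lemma det_souriau_ne_zero {L : Submodule ℝ (PhaseSpace n)} (hL : IsLagrangian L) :
    (souriau L).det ≠ 0 := by
  obtain ⟨K, S, hS, rfl, -⟩ := exists_adapted_chart hL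
  have hD := cayleyDet_ne_zero hS
  rw [det_souriau_chart K hS]
  exact mul_ne_zero (pow_ne_zero _ (by simp)) (div_ne_zero hD (by simpa using hD))

lemma continuous_det_souriau :
    Continuous fun L : LagrangianGrassmannian n => (souriau L.1).det := by
  refine Continuous.matrix_det (continuous_matrix fun i j => ?_)
  simp only [souriau, Matrix.of_apply]
  exact (Complex.continuous_ofReal.comp (((continuous_projBase.matrix_elem i j).const_mul 2).sub
    continuous_const)).add ((Complex.continuous_ofReal.comp
      ((continuous_projCross.matrix_elem i j).const_mul 2)).const_mul _)

/-- Nonvanishing continuous functions on a normed space have continuous logarithms. -/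
lemma exists_continuous_log {V : Type*} [NormedAddCommGroup V] [NormedSpace ℝ V] (f : C(V, ℂ))
    (hf : ∀ v, f v ≠ 0) : ∃ g : C(V, ℂ), ∀ v, Complex.exp (g v) = f v := by
  have : ContractibleSpace V := RealTopologicalVectorSpace.contractibleSpace
  obtain ⟨g, ⟨-, hg⟩, -⟩ := Complex.isCoveringMapOn_exp.existsUnique_continuousMap_lifts f
    (a₀ := 0) (e₀ := Complex.log (f 0)) (Complex.exp_log (hf 0)) hf
  exact ⟨g, fun v => congrFun hg v⟩

/-- Logarithms of the same function which agree at a point agree on a connected set. -/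
lemma eqOn_of_exp_eqOn {T : Type*} [TopologicalSpace T] {s : Set T} (hs : IsPreconnected s)
    {g₁ g₂ : T → ℂ} (h₁ : ContinuousOn g₁ s) (h₂ : ContinuousOn g₂ s)
    (he : ∀ t ∈ s, Complex.exp (g₁ t) = Complex.exp (g₂ t)) {t₀ : T} (ht₀ : t₀ ∈ s)
    (h : g₁ t₀ = g₂ t₀) : ∀ t ∈ s, g₁ t = g₂ t :=
  Complex.isCoveringMap_exp.eqOn_of_comp_eqOn hs h₁ h₂
    (fun t ht => Subtype.ext (he t ht)) ht₀ h

lemma continuous_cayleyDet : Continuous (cayleyDet : Matrix (Fin n) (Fin n) ℝ → ℂ) :=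
  Continuous.matrix_det (continuous_const.add
    ((continuous_id.matrix_map Complex.continuous_ofReal).const_smul Complex.I))

/-- Precomposing with the symmetric part gives a nowhere vanishing function on the contractible
space of all matrices, which therefore has a global logarithm. -/
lemma exists_cayleyLog (n : ℕ) : ∃ Ψ : Matrix (Fin n) (Fin n) ℝ → ℂ, Continuous Ψ ∧
    ∀ S : Matrix (Fin n) (Fin n) ℝ, S.IsSymm →
      Complex.exp (Ψ S) = cayleyDet S / (starRingEnd ℂ) (cayleyDet S) := by
  have hD : ∀ S : Matrix (Fin n) (Fin n) ℝ, cayleyDet (symmPart S) ≠ 0 := fun S =>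
    cayleyDet_ne_zero (isSymm_symmPart S)
  have hc : Continuous fun S : Matrix (Fin n) (Fin n) ℝ => cayleyDet (symmPart S) :=
    continuous_cayleyDet.comp continuous_symmPart
  obtain ⟨g, hg⟩ := exists_continuous_log (V := Fin n → Fin n → ℝ)
    ⟨fun S => cayleyDet (symmPart S) / (starRingEnd ℂ) (cayleyDet (symmPart S)),
      hc.div (Complex.continuous_conj.comp hc) fun S => by simpa using hD S⟩
    (fun S => div_ne_zero (hD S) (by simpa using hD S))
  refine ⟨g, g.continuous, fun S hS => ?_⟩
  rw [hg S]
  change cayleyDet (symmPart S) / (starRingEnd ℂ) (cayleyDet (symmPart S)) = _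
  rw [symmPart_eq_self hS]

/-- A continuous logarithm of `det (1 + iS) / det (1 - iS)`, for symmetric `S`. -/
def cayleyLog {n : ℕ} : Matrix (Fin n) (Fin n) ℝ → ℂ := (exists_cayleyLog n).choose

lemma continuous_cayleyLog : Continuous (cayleyLog : Matrix (Fin n) (Fin n) ℝ → ℂ) :=
  (exists_cayleyLog n).choose_spec.1

lemma exp_cayleyLog {S : Matrix (Fin n) (Fin n) ℝ} (hS : S.IsSymm) :
    Complex.exp (cayleyLog S) = cayleyDet S / (starRingEnd ℂ) (cayleyDet S) :=
  (exists_cayleyLog n).choose_spec.2 S hS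

lemma det_souriau_chart_eq_exp (K : Finset (Fin n)) {S : Matrix (Fin n) (Fin n) ℝ}
    (hS : S.IsSymm) :
    (souriau (chart K S)).det = (-1) ^ K.card * Complex.exp (cayleyLog S) := by
  rw [det_souriau_chart K hS, exp_cayleyLog hS]

/-- The logarithm of `det W` on the set of Lagrangians transversal to `σ`. -/
def graphLog (L : LagrangianGrassmannian n) : ℂ := cayleyLog (graphMatrix L)

lemma exp_graphLog {L : LagrangianGrassmannian n} (h : interDim L.1 = 0) :
    Complex.exp (graphLog L) = (souriau L.1).det := by
  obtain ⟨h1, h2⟩ := chart_graphMatrix h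
  rw [graphLog]
  conv_rhs => rw [h2]
  rw [det_souriau_chart_eq_exp ∅ h1]
  simp

lemma continuousAt_graphLog {L : LagrangianGrassmannian n} (h : interDim L.1 = 0) :
    ContinuousAt graphLog L :=
  ContinuousAt.comp continuous_cayleyLog.continuousAt (continuousAt_graphMatrix h)

lemma isSymm_diagonal_single (κ : Fin n) (s : ℝ) :
    (Matrix.diagonal (Pi.single κ s : Fin n → ℝ)).IsSymm := Matrix.diagonal_transpose _

lemma cayleyDet_diagonal_single (κ : Fin n) (s : ℝ) :
    cayleyDet (Matrix.diagonal (Pi.single κ s : Fin n → ℝ)) = 1 + Complex.I * s := by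
  have : (1 + Complex.I • (Matrix.diagonal (Pi.single κ s : Fin n → ℝ)).map Complex.ofReal) =
      Matrix.diagonal fun i => if i = κ then 1 + Complex.I * s else 1 := by
    ext i j
    by_cases h : i = j
    · subst h
      by_cases h' : i = κ <;> simp [h', Pi.single_apply]
    · simp [h]
  rw [cayleyDet, this, Matrix.det_diagonal]
  simp

/-- With `tan u` as the only nonzero entry, at `(κ, κ)`, the quotient is `exp (2iu)`; from `u =
-π/4` to `u = π/4` its logarithm grows by `πi`. -/
lemma cayleyLog_single_sub (κ : Fin n) :
    cayleyLog (Matrix.diagonal (Pi.single κ 1 : Fin n → ℝ)) -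
      cayleyLog (Matrix.diagonal (Pi.single κ (-1) : Fin n → ℝ)) = Real.pi * Complex.I := by
  have hpi := Real.pi_pos
  set g : ℝ → ℂ := fun u => cayleyLog (Matrix.diagonal (Pi.single κ (Real.tan u) : Fin n → ℝ))
    with hg
  have hcont : ContinuousOn g (Set.Ioo (-(Real.pi / 2)) (Real.pi / 2)) := by
    have h1 : Continuous fun s : ℝ => Matrix.diagonal (Pi.single κ s : Fin n → ℝ) :=
      Continuous.matrix_diagonal (continuous_single (A := fun _ : Fin n => ℝ) κ)
    exact (continuous_cayleyLog.comp h1).comp_continuousOn Real.continuousOn_tan_Ioo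
  have hexp : ∀ u ∈ Set.Ioo (-(Real.pi / 2)) (Real.pi / 2),
      Complex.exp (g u) = Complex.exp (2 * u * Complex.I) := by
    intro u hu
    rw [hg, exp_cayleyLog (isSymm_diagonal_single κ _), cayleyDet_diagonal_single]
    have hc : (Real.cos u : ℂ) ≠ 0 := by
      exact_mod_cast (Real.cos_pos_of_mem_Ioo hu).ne'
    have h1 : (1 + Complex.I * (Real.tan u : ℂ)) = Complex.exp (u * Complex.I) / Real.cos u := by
      rw [Complex.exp_mul_I, Real.tan_eq_sin_div_cos, eq_div_iff hc]
      push_cast at hc ⊢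
      field_simp
    have h2 : (starRingEnd ℂ) (Complex.exp (u * Complex.I) / Real.cos u) =
        Complex.exp (-(u * Complex.I)) / Real.cos u := by
      rw [map_div₀, Complex.conj_ofReal, ← Complex.exp_conj]
      simp
    rw [h1, h2, div_div_div_cancel_right₀ hc, ← Complex.exp_sub]
    congr 1
    ring
  have h0 : (0 : ℝ) ∈ Set.Ioo (-(Real.pi / 2)) (Real.pi / 2) := ⟨by linarith, by linarith⟩
  have key := eqOn_of_exp_eqOn (g₁ := g) (g₂ := fun u => 2 * u * Complex.I + g 0)
    isPreconnected_Ioo hcont (by fun_prop) (fun u hu => by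
      rw [Complex.exp_add, hexp 0 h0, hexp u hu]; simp) h0 (by simp)
  have hp := key (Real.pi / 4) ⟨by linarith, by linarith⟩
  have hm := key (-(Real.pi / 4)) ⟨by linarith, by linarith⟩
  simp only [hg, Real.tan_neg, Real.tan_pi_div_four] at hp hm
  rw [hp, hm]
  push_cast
  ring

lemma graphMatrix_chartPoint_single {κ : Fin n} {s : ℝ} (hs : s ≠ 0) :
    graphMatrix (chartPoint {κ} (Matrix.diagonal (Pi.single κ s : Fin n → ℝ))) =
      Matrix.diagonal (Pi.single κ (-s⁻¹) : Fin n → ℝ) := by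
  refine graphMatrix_eq (isSymm_diagonal_single κ _) ?_
  rw [chartPoint_val _ (isSymm_diagonal_single κ s), chart_diagonal_eq (Finset.empty_subset _)]
  · congr 2
    ext i
    by_cases h : i = κ
    · subst h; simp
    · simp [h]
  · intro i hi _
    rw [Finset.mem_singleton] at hi
    subst hi
    simpa using hs

/-- The logarithm on the Lagrangians transversal to `σ` jumps by `-2πi` across the Maslov cycle. -/
lemma graphLog_chartPoint_sub {κ : Fin n} {ε : ℝ} (hε : ε = 1 ∨ ε = -1)
    {S : Matrix (Fin n) (Fin n) ℝ} (hS : S.IsSymm) (h : 0 < ε * S κ κ) :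
    graphLog (chartPoint {κ} S) - cayleyLog S = -(ε * Real.pi * Complex.I) := by
  -- On this convex set both logarithms are continuous, and `exp` of their difference is `-1`
  -- because the chart has one index. The difference is therefore constant, and one diagonal matrix
  -- suffices to find it.
  set U : Set (Matrix (Fin n) (Fin n) ℝ) := {S | S.IsSymm ∧ 0 < ε * S κ κ} with hU
  have hconv : Convex ℝ U := by
    rintro S ⟨h1, h2⟩ S' ⟨h1', h2'⟩ a b ha hb hab
    refine ⟨?_, ?_⟩
    · rw [Matrix.IsSymm, Matrix.transpose_add, Matrix.transpose_smul, Matrix.transpose_smul, h1.eq,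
        h1'.eq]
    · have : ε * (a • S + b • S') κ κ = a * (ε * S κ κ) + b * (ε * S' κ κ) := by
        simp only [Matrix.add_apply, Matrix.smul_apply, smul_eq_mul]
        ring
      rw [this]
      rcases ha.eq_or_lt with rfl | ha
      · have : b = 1 := by linarith
        subst this; linarith
      · have := mul_pos ha h2
        have := mul_nonneg hb h2'.le
        linarith
  have hzero : ∀ S ∈ U, interDim (chartPoint {κ} S).1 = 0 := by
    rintro S ⟨h1, h2⟩
    rw [chartPoint_val _ h1]
    exact interDim_chart_singleton_eq_zero fun h0 => by simp [h0] at h2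
  have hpi2 : Complex.exp (ε * Real.pi * Complex.I) = -1 := by
    rcases hε with rfl | rfl
    · simp [Complex.exp_pi_mul_I]
    · simp [Complex.exp_neg, Complex.exp_pi_mul_I]
  have hεU : Matrix.diagonal (Pi.single κ ε : Fin n → ℝ) ∈ U := by
    refine ⟨isSymm_diagonal_single κ ε, ?_⟩
    rcases hε with rfl | rfl <;> simp
  refine eqOn_of_exp_eqOn (s := U) (g₁ := fun S => graphLog (chartPoint {κ} S) - cayleyLog S)
    (g₂ := fun _ => -(ε * Real.pi * Complex.I)) hconv.isPreconnected ?_ continuousOn_const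
    ?_ hεU ?_ S ⟨hS, h⟩
  · intro S hS
    refine ContinuousAt.continuousWithinAt (ContinuousAt.sub ?_ continuous_cayleyLog.continuousAt)
    exact ContinuousAt.comp (f := chartPoint {κ}) (continuousAt_graphLog (hzero S hS))
      (continuous_chartPoint {κ}).continuousAt
  · intro S hS
    rw [Complex.exp_sub, exp_graphLog (hzero S hS), chartPoint_val _ hS.1,
      det_souriau_chart_eq_exp _ hS.1, Complex.exp_neg, hpi2, Finset.card_singleton, pow_one,
      mul_div_assoc, div_self (Complex.exp_ne_zero _)]
    norm_num
  -- At the sample point the entry `ε` in the chart `{κ}` becomes the entry `-ε⁻¹ = -ε` of the graph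
  -- matrix.
  · have h1 := cayleyLog_single_sub κ
    simp only [graphLog]
    rcases hε with rfl | rfl
    · rw [graphMatrix_chartPoint_single one_ne_zero, inv_one, ← neg_sub, h1]
      simp
    · rw [graphMatrix_chartPoint_single (by norm_num), inv_neg, inv_one, neg_neg, h1]
      simp

/-! ### Homotopy invariance of signed counts -/

/-- Logarithms of one number differ by multiples of `2πi`, so they coincide once they are closer
than `2π`. -/
lemma eventually_eq_of_exp_eq {T : Type*} {l : Filter T} {g : T → ℂ} {c : ℂ}
    (h : Filter.Tendsto g l (𝓝 c)) (he : ∀ᶠ t in l, Complex.exp (g t) = Complex.exp c) :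
    ∀ᶠ t in l, g t = c := by
  have h1 := (Metric.tendsto_nhds.1 h) (2 * Real.pi) (by positivity)
  filter_upwards [h1, he] with t ht1 ht2
  obtain ⟨k, hk⟩ := Complex.exp_eq_exp_iff_exists_int.1 ht2
  rw [hk, dist_eq_norm, add_sub_cancel_left, norm_mul, norm_mul, Complex.norm_I,
    mul_one, norm_mul, Complex.norm_intCast, Complex.norm_real, Complex.norm_ofNat,
    Real.norm_of_nonneg Real.pi_pos.le] at ht1
  have h2 : |(k : ℝ)| < 1 := by
    by_contra hcon
    push Not at hcon
    have := mul_le_mul_of_nonneg_right hcon (by positivity : 0 ≤ 2 * Real.pi)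
    linarith
  have h3 : k = 0 := by
    rw [← Int.cast_abs] at h2
    exact Int.abs_lt_one_iff.1 (by exact_mod_cast h2)
  rw [hk, h3]
  simp

/-- The total variation of a piecewise constant function is the sum of its jumps. -/
lemma sub_eq_sum_jumps {a b : ℝ} (hab : a ≤ b) {g j : ℝ → ℂ} (T : Finset ℝ)
    (hT : ∀ t ∈ T, t ∈ Set.Ioo a b)
    (h1 : ∀ u ∈ Set.Icc a b, u ∉ T → ∀ᶠ v in 𝓝[Set.Icc a b] u, g v = g u)
    (h2 : ∀ u ∈ T, ∃ c, (∀ᶠ v in 𝓝[<] u, g v = c) ∧ ∀ᶠ v in 𝓝[>] u, g v = c + j u) :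
    g b - g a = ∑ t ∈ T, j t := by
  choose! c hc1 hc2 using h2
  -- Subtracting the jumps up to time `u`, and using the right-hand limit as the value of `g` at
  -- points of `T`, leaves a locally constant function on `[a, b]`.
  set G : ℝ → ℂ := fun u => (if u ∈ T then c u + j u else g u) - ∑ t ∈ T with t ≤ u, j t with hG
  have hoff : ∀ u, ∀ᶠ v in 𝓝 u, (v ≠ u → v ∉ T) ∧ ∀ t ∈ T, t ≠ u → (t ≤ v ↔ t ≤ u) := by
    intro u
    have hfin : ∀ᶠ v in 𝓝 u, ∀ t ∈ T, t ≠ u → (t ≤ v ↔ t ≤ u) := by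
      rw [Filter.eventually_all_finset]
      intro t _
      rcases lt_trichotomy t u with h | h | h
      · filter_upwards [lt_mem_nhds h] with v hv _
        exact ⟨fun _ => h.le, fun _ => le_of_lt hv⟩
      · exact Filter.Eventually.of_forall fun v hv => absurd h hv
      · filter_upwards [gt_mem_nhds h] with v hv _
        exact ⟨fun h' => absurd hv (not_lt.2 h'), fun h' => absurd h (not_lt.2 h')⟩
    have hcl : ∀ᶠ v in 𝓝 u, v ∉ T.erase u :=
      (T.erase u).finite_toSet.isClosed.isOpen_compl.mem_nhds (by simp)
    filter_upwards [hfin, hcl] with v hv1 hv2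
    exact ⟨fun hne hvT => hv2 (Finset.mem_erase.2 ⟨hne, hvT⟩), hv1⟩
  have hloc : ∀ u ∈ Set.Icc a b, ∀ᶠ v in 𝓝[Set.Icc a b] u, G v = G u := by
    intro u hu
    have hoff' := (hoff u).filter_mono (nhdsWithin_le_nhds (s := Set.Icc a b))
    by_cases huT : u ∈ T
    · have hl := eventually_nhdsWithin_iff.1 (hc1 u huT)
      have hr := eventually_nhdsWithin_iff.1 (hc2 u huT)
      filter_upwards [hoff', hl.filter_mono nhdsWithin_le_nhds,
        hr.filter_mono nhdsWithin_le_nhds] with v hv hvl hvr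
      rcases lt_trichotomy v u with h | h | h
      · have hset : T.filter (· ≤ u) = insert u (T.filter (· ≤ v)) := by
          ext t
          simp only [Finset.mem_filter, Finset.mem_insert]
          constructor
          · rintro ⟨ht, htu⟩
            by_cases he : t = u
            · exact Or.inl he
            · exact Or.inr ⟨ht, (hv.2 t ht he).2 htu⟩
          · rintro (rfl | ⟨ht, htv⟩)
            · exact ⟨huT, le_rfl⟩
            · exact ⟨ht, htv.trans h.le⟩
        simp only [hG, if_pos huT, if_neg (hv.1 h.ne), hset]
        rw [Finset.sum_insert (by simp [h]), hvl h]
        ring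
      · rw [h]
      · have hset : T.filter (· ≤ u) = T.filter (· ≤ v) := by
          refine Finset.filter_congr fun t ht => ?_
          by_cases he : t = u
          · subst he; exact ⟨fun _ => h.le, fun _ => le_rfl⟩
          · exact (hv.2 t ht he).symm
        simp only [hG, if_pos huT, if_neg (hv.1 h.ne'), hset]
        rw [hvr h]
    · filter_upwards [hoff', h1 u hu huT] with v hv hvu
      have hvT : v ∉ T := by
        by_cases he : v = u
        · rwa [he]
        · exact hv.1 he
      simp only [hG, if_neg huT, if_neg hvT, hvu]
      congr 1
      refine Finset.sum_congr (Finset.filter_congr fun t ht => ?_) fun _ _ => rfl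
      exact hv.2 t ht fun h => huT (h ▸ ht)
  have hconst : IsLocallyConstant fun u : Set.Icc a b => G u := by
    rw [IsLocallyConstant.iff_eventually_eq]
    intro u
    have := hloc u u.2
    rw [nhdsWithin_eq_map_subtype_coe u.2] at this
    exact this
  have : PreconnectedSpace (Set.Icc a b) := Subtype.preconnectedSpace isPreconnected_Icc
  have hab' := hconst.apply_eq_of_preconnectedSpace ⟨a, Set.left_mem_Icc.2 hab⟩
    ⟨b, Set.right_mem_Icc.2 hab⟩
  have haT : a ∉ T := fun h => lt_irrefl _ (hT a h).1
  have hbT : b ∉ T := fun h => lt_irrefl _ (hT b h).2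
  have hfa : T.filter (· ≤ a) = ∅ :=
    Finset.filter_eq_empty_iff.2 fun t ht => not_le.2 (hT t ht).1
  have hfb : T.filter (· ≤ b) = T := Finset.filter_true_of_mem fun t ht => (hT t ht).2.le
  simp only [hG, if_neg haT, if_neg hbT, hfa, hfb, Finset.sum_empty] at hab'
  linear_combination -hab'

lemma eventually_sign_of_hasDerivAt {f : ℝ → ℝ} {f' t e : ℝ} (h : HasDerivAt f f' t)
    (h0 : f t = 0) (he : 0 < e * f') :
    (∀ᶠ v in 𝓝[<] t, 0 < -e * f v) ∧ ∀ᶠ v in 𝓝[>] t, 0 < e * f v := by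
  have h1 := (hasDerivAt_iff_tendsto_slope.1 h).const_mul e
  have h2 := h1.eventually (lt_mem_nhds he)
  have key : ∀ v, v ≠ t → e * slope f t v * (v - t) = e * f v := fun v hv => by
    have : v - t ≠ 0 := sub_ne_zero.2 hv
    rw [slope_def_field, h0]
    field_simp
    ring
  constructor
  · filter_upwards [h2.filter_mono (nhdsWithin_mono t fun v hv => ne_of_lt hv),
      self_mem_nhdsWithin] with v hv hvt
    have hvt' : v < t := hvt
    have := key v hvt'.ne
    have := mul_pos hv (sub_pos.2 hvt')
    nlinarith
  · filter_upwards [h2.filter_mono (nhdsWithin_mono t fun v hv => ne_of_gt hv),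
      self_mem_nhdsWithin] with v hv hvt
    have hvt' : t < v := hvt
    rw [← key v hvt'.ne']
    exact mul_pos hv (sub_pos.2 hvt')

/-- Near `t`, `θ` and `cayleyLog ∘ S` differ by a constant, since up to the sign of the chart both
are logarithms of `det W`. The jump thus comes from `graphLog - cayleyLog`, as `e * S κ κ` passes
from negative to positive, where `e = o * s`. -/
lemma exists_jump_of_crossesWithSign {a b : ℝ} (hab : a ≤ b) {o : ℤˣ}
    {η : C(Set.Icc a b, LagrangianGrassmannian n)} {t : Set.Icc a b} {s : ℤˣ}
    (ht : (t : ℝ) ∈ Set.Ioo a b) (h : CrossesWithSign o η t s) {θ : ℝ → ℂ} (hθ : Continuous θ)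
    (hθη : ∀ u, Complex.exp (θ u) = (souriau (η (Set.projIcc a b hab u)).1).det) :
    ∃ c, (∀ᶠ v in 𝓝[<] (t : ℝ), θ v - graphLog (η (Set.projIcc a b hab v)) = c) ∧
      ∀ᶠ v in 𝓝[>] (t : ℝ), θ v - graphLog (η (Set.projIcc a b hab v)) =
        c + 2 * Real.pi * Complex.I * (((o * s : ℤˣ) : ℤ) : ℂ) := by
  obtain ⟨h1, κ, S, S', hS, hS', hpos⟩ := h
  have hS2 : ∀ᶠ v in 𝓝 (t : ℝ), (S v).IsSymm ∧ η (Set.projIcc a b hab v) = chartPoint {κ} (S v) := by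
    have hp : Filter.Tendsto (Set.projIcc a b hab) (𝓝 (t : ℝ)) (𝓝 t) := by
      have := (continuous_projIcc (h := hab)).tendsto (t : ℝ)
      rwa [Set.projIcc_val] at this
    filter_upwards [hp.eventually hS, Ioo_mem_nhds ht.1 ht.2] with v hv hvI
    have : ((Set.projIcc a b hab v : Set.Icc a b) : ℝ) = v := by
      rw [Set.projIcc_of_mem hab (Set.Ioo_subset_Icc_self hvI)]
    rw [this] at hv
    exact ⟨hv.1, Subtype.ext (hv.2.trans (chartPoint_val _ hv.1).symm)⟩
  have hScont : ContinuousAt S t := by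
    refine tendsto_pi_nhds.2 fun i => tendsto_pi_nhds.2 fun j => ?_
    exact (hS' i j).continuousAt
  have hSt := hS2.self_of_nhds
  have hzero : S t κ κ = 0 := by
    by_contra hne
    have h2 : interDim (η t).1 = 1 := h1
    have h3 := hSt.2
    rw [Set.projIcc_val] at h3
    rw [h3, chartPoint_val _ hSt.1, interDim_chart_singleton_eq_zero hne] at h2
    exact zero_ne_one h2
  set e : ℝ := (((o * s : ℤˣ) : ℤ) : ℝ) with he
  have he1 : e = 1 ∨ e = -1 := by
    rcases Int.units_eq_one_or (o * s) with h | h <;> simp [he, h]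
  obtain ⟨hneg, hposi⟩ := eventually_sign_of_hasDerivAt (hS' κ κ) hzero hpos
  have hr : ∀ᶠ v in 𝓝 (t : ℝ), θ v - cayleyLog (S v) = θ t - cayleyLog (S t) := by
    have hexp : ∀ᶠ v in 𝓝 (t : ℝ), Complex.exp (θ v - cayleyLog (S v)) = -1 := by
      filter_upwards [hS2] with v hv
      rw [Complex.exp_sub, hθη, hv.2, chartPoint_val _ hv.1, det_souriau_chart_eq_exp _ hv.1,
        Finset.card_singleton, pow_one, mul_div_assoc, div_self (Complex.exp_ne_zero _), mul_one]
    refine eventually_eq_of_exp_eq (ContinuousAt.sub hθ.continuousAt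
      (ContinuousAt.comp continuous_cayleyLog.continuousAt hScont)) ?_
    filter_upwards [hexp] with v hv
    exact hv.trans hexp.self_of_nhds.symm
  -- Just before `t`, `graphLog - cayleyLog` is `eπi`; just after, it is `-eπi`.
  refine ⟨θ t - cayleyLog (S t) - e * Real.pi * Complex.I, ?_, ?_⟩
  · filter_upwards [hneg, hr.filter_mono nhdsWithin_le_nhds, hS2.filter_mono nhdsWithin_le_nhds]
      with v hv hvr hvS
    have h3 := graphLog_chartPoint_sub (ε := -e) (by rcases he1 with h | h <;> simp [h]) hvS.1 hv
    rw [hvS.2, ← hvr]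
    push_cast at h3
    linear_combination -h3
  · filter_upwards [hposi, hr.filter_mono nhdsWithin_le_nhds, hS2.filter_mono nhdsWithin_le_nhds]
      with v hv hvr hvS
    have h3 := graphLog_chartPoint_sub he1 hvS.1 hv
    have h4 : (((o * s : ℤˣ) : ℤ) : ℂ) = (e : ℂ) := by
      rw [he]; push_cast; rfl
    rw [hvS.2, ← hvr, h4]
    linear_combination -h3

/-- The signed count of a curve with transversal intersections is determined by any continuous
logarithm of `det W` along the curve and by the end points. -/
theorem IsSignedCount.eq_log_sub {a b : ℝ} (hab : a ≤ b) {o : ℤˣ}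
    {η : C(Set.Icc a b, LagrangianGrassmannian n)} {m : ℤ} (h : IsSignedCount o η m)
    (hend : ∀ t : Set.Icc a b, ((t : ℝ) = a ∨ (t : ℝ) = b) → η t ∈ stratum n 0)
    {θ : ℝ → ℂ} (hθ : Continuous θ)
    (hθη : ∀ u, Complex.exp (θ u) = (souriau (η (Set.projIcc a b hab u)).1).det) :
    θ b - graphLog (η ⟨b, Set.right_mem_Icc.2 hab⟩) -
      (θ a - graphLog (η ⟨a, Set.left_mem_Icc.2 hab⟩)) =
      2 * Real.pi * Complex.I * ((((o : ℤˣ) : ℤ) * m : ℤ) : ℂ) := by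
  obtain ⟨T, s, hT, hcross, rfl⟩ := h
  have hTI : ∀ t ∈ T, (t : ℝ) ∈ Set.Ioo a b := by
    intro t ht
    have h0 : ¬ ((t : ℝ) = a ∨ (t : ℝ) = b) := fun hcon =>
      mem_maslovCycle.1 ((hT t).1 ht) (hend t hcon)
    push Not at h0
    exact ⟨lt_of_le_of_ne t.2.1 h0.1.symm, lt_of_le_of_ne t.2.2 h0.2⟩
  have key := sub_eq_sum_jumps hab (g := fun u => θ u - graphLog (η (Set.projIcc a b hab u)))
    (j := fun u => 2 * Real.pi * Complex.I * (((o * s (Set.projIcc a b hab u) : ℤˣ) : ℤ) : ℂ))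
    (T.map (Function.Embedding.subtype _)) ?_ ?_ ?_
  · rw [Finset.sum_map] at key
    simp only [Function.Embedding.coe_subtype, Set.projIcc_val, Set.projIcc_left,
      Set.projIcc_right] at key
    rw [key]
    push_cast
    rw [Finset.mul_sum, Finset.mul_sum]
  · intro t ht
    obtain ⟨t, ht', rfl⟩ := Finset.mem_map.1 ht
    exact hTI t ht'
  · intro u hu huT
    have hnot : (Set.projIcc a b hab u) ∉ T := fun hcon => huT <| Finset.mem_map.2
      ⟨_, hcon, by simp [Set.projIcc_of_mem hab hu]⟩
    have h0 : interDim (η (Set.projIcc a b hab u)).1 = 0 := by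
      by_contra hne
      exact hnot ((hT _).2 (mem_maslovCycle.2 hne))
    have hc : ContinuousAt (fun v => η (Set.projIcc a b hab v)) u :=
      (η.continuous.comp continuous_projIcc).continuousAt
    have hev : ∀ᶠ v in 𝓝 u, interDim (η (Set.projIcc a b hab v)).1 = 0 :=
      hc.eventually (isOpen_interDim_eq_zero.mem_nhds h0)
    refine Filter.Eventually.filter_mono nhdsWithin_le_nhds (eventually_eq_of_exp_eq
      (ContinuousAt.sub hθ.continuousAt (ContinuousAt.comp
        (f := fun v => η (Set.projIcc a b hab v)) (continuousAt_graphLog h0) hc)) ?_)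
    filter_upwards [hev] with v hv
    rw [Complex.exp_sub, Complex.exp_sub, exp_graphLog hv, exp_graphLog h0, hθη, hθη,
      div_self (det_souriau_ne_zero (η _).2), div_self (det_souriau_ne_zero (η _).2)]
  · intro u hu
    obtain ⟨t, ht, rfl⟩ := Finset.mem_map.1 hu
    simp only [Function.Embedding.coe_subtype, Set.projIcc_val]
    exact exists_jump_of_crossesWithSign hab (hTI t ht) (hcross t ht) hθ hθη

/-- The intersection index is unique. -/
theorem IsIntersectionIndex.unique {a b : ℝ} (hab : a ≤ b) {o : ℤˣ}
    {γ : C(Set.Icc a b, LagrangianGrassmannian n)} {m₁ m₂ : ℤ}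
    (h₁ : IsIntersectionIndex o γ m₁) (h₂ : IsIntersectionIndex o γ m₂) : m₁ = m₂ := by
  obtain ⟨hend, η₁, hη₁, hc₁⟩ := h₁
  obtain ⟨-, η₂, hη₂, hc₂⟩ := h₂
  set ta : Set.Icc a b := ⟨a, Set.left_mem_Icc.2 hab⟩ with hta
  set tb : Set.Icc a b := ⟨b, Set.right_mem_Icc.2 hab⟩ with htb
  have ha₁ : ∀ t : Set.Icc a b, ((t : ℝ) = a ∨ (t : ℝ) = b) → η₁ t = γ t := fun t ht =>
    (hη₁.fst_eq_snd ht).symm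
  have ha₂ : ∀ t : Set.Icc a b, ((t : ℝ) = a ∨ (t : ℝ) = b) → η₂ t = γ t := fun t ht =>
    (hη₂.fst_eq_snd ht).symm
  -- The two homotopies are joined through `γ`. Pulled back to the plane, `det W` along `H` has a
  -- logarithm `g`, whose restrictions to two opposite edges serve as `θ` for `η₁` and `η₂`.
  obtain ⟨H⟩ := hη₁.symm.trans hη₂
  have hfc : Continuous fun p : ℝ × ℝ => (souriau (H (Set.projIcc 0 1 zero_le_one p.1,
      Set.projIcc a b hab p.2)).1).det :=
    continuous_det_souriau.comp (H.continuous.comp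
      ((continuous_projIcc.comp continuous_fst).prodMk (continuous_projIcc.comp continuous_snd)))
  obtain ⟨g, hg⟩ := exists_continuous_log ⟨_, hfc⟩ fun p => det_souriau_ne_zero (H _).2
  simp only [ContinuousMap.coe_mk] at hg
  -- The end points do not move under `H`, so `g` is constant on the other two edges and the total
  -- changes of the two logarithms agree.
  have hconst : ∀ t : Set.Icc a b, ((t : ℝ) = a ∨ (t : ℝ) = b) → g (0, t) = g (1, t) := by
    intro t ht
    refine (eqOn_of_exp_eqOn (s := Set.univ) (g₁ := fun x : ℝ => g (x, t))
      (g₂ := fun _ => g (0, t)) isPreconnected_univ (by fun_prop) continuousOn_const ?_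
      (Set.mem_univ 0) rfl 1 (Set.mem_univ 1)).symm
    intro x _
    rw [hg, hg]
    simp only [Set.projIcc_val]
    rw [H.eq_fst _ ht, H.eq_fst _ ht]
  have e₁ := hc₁.eq_log_sub hab (fun t ht => ha₁ t ht ▸ hend t ht) (θ := fun u => g (0, u))
    (by fun_prop) (fun u => by rw [hg]; simp)
  have e₂ := hc₂.eq_log_sub hab (fun t ht => ha₂ t ht ▸ hend t ht) (θ := fun u => g (1, u))
    (by fun_prop) (fun u => by rw [hg]; simp)
  rw [ha₁ tb (Or.inr rfl), ha₁ ta (Or.inl rfl)] at e₁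
  rw [ha₂ tb (Or.inr rfl), ha₂ ta (Or.inl rfl), ← hconst ta (Or.inl rfl), ← hconst tb (Or.inr rfl),
    e₁] at e₂
  have hne : (2 * Real.pi * Complex.I : ℂ) ≠ 0 := Complex.two_pi_I_ne_zero
  have h3 := mul_left_cancel₀ hne e₂
  have h4 : ((o : ℤˣ) : ℤ) * m₁ = ((o : ℤˣ) : ℤ) * m₂ := by exact_mod_cast h3
  exact mul_left_cancel₀ o.ne_zero h4

/-! ### Resolution of degenerate intersections -/

lemma homotopicRel_mono {X Y : Type*} [TopologicalSpace X] [TopologicalSpace Y] {f g : C(X, Y)}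
    {s t : Set X} (h : f.HomotopicRel g t) (hst : s ⊆ t) : f.HomotopicRel g s := by
  obtain ⟨F⟩ := h
  exact ⟨⟨F.toHomotopy, fun r x hx => F.prop r x (hst hx)⟩⟩

/-- A curve may be replaced within a chart, up to homotopy. -/
lemma exists_replacement (Γ : C(ℝ, LagrangianGrassmannian n)) {c d : ℝ} (hcd : c ≤ d)
    {K : Finset (Fin n)} {S₀ S₁ : ℝ → Matrix (Fin n) (Fin n) ℝ}
    (h₀ : ContinuousOn S₀ (Set.Icc c d)) (h₁ : ContinuousOn S₁ (Set.Icc c d))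
    (hs₀ : ∀ u ∈ Set.Icc c d, (S₀ u).IsSymm) (hs₁ : ∀ u ∈ Set.Icc c d, (S₁ u).IsSymm)
    (hc : S₁ c = S₀ c) (hd : S₁ d = S₀ d)
    (hΓ : ∀ u ∈ Set.Icc c d, (Γ u).1 = chart K (S₀ u)) :
    ∃ Η : C(ℝ, LagrangianGrassmannian n), (∀ u ∉ Set.Ioo c d, Η u = Γ u) ∧
      (∀ u ∈ Set.Icc c d, (Η u).1 = chart K (S₁ u)) ∧ Γ.HomotopicRel Η (Set.Ioo c d)ᶜ := by
  classical
  -- Straight-line homotopy of the coordinates over `[c, d]`, and no change elsewhere; the pieces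
  -- fit because `S₁` and `S₀` agree at `c` and `d`.
  set h : unitInterval × ℝ → LagrangianGrassmannian n := fun p =>
    if p.2 ∈ Set.Icc c d then chartPoint K ((1 - (p.1 : ℝ)) • S₀ p.2 + (p.1 : ℝ) • S₁ p.2)
    else Γ p.2 with hh
  have hoff : ∀ p : unitInterval × ℝ, p.2 ∉ Set.Ioo c d → h p = Γ p.2 := by
    rintro ⟨s, u⟩ hu
    by_cases hu' : u ∈ Set.Icc c d
    · have hS : S₁ u = S₀ u := by
        have : u = c ∨ u = d := by
          by_contra hcon
          push Not at hcon
          exact hu ⟨lt_of_le_of_ne hu'.1 hcon.1.symm, lt_of_le_of_ne hu'.2 hcon.2⟩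
        rcases this with rfl | rfl <;> assumption
      simp only [hh, if_pos hu']
      rw [hS, ← add_smul, sub_add_cancel, one_smul]
      exact Subtype.ext ((chartPoint_val K (hs₀ u hu')).trans (hΓ u hu').symm)
    · simp only [hh, if_neg hu']
  have hA : IsClosed {p : unitInterval × ℝ | p.2 ∈ Set.Icc c d} :=
    isClosed_Icc.preimage continuous_snd
  have hB : IsClosed {p : unitInterval × ℝ | p.2 ∉ Set.Ioo c d} :=
    isOpen_Ioo.isClosed_compl.preimage continuous_snd
  have hcA : ContinuousOn h {p : unitInterval × ℝ | p.2 ∈ Set.Icc c d} := by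
    have hm : Set.MapsTo (fun p : unitInterval × ℝ => p.2)
      {p : unitInterval × ℝ | p.2 ∈ Set.Icc c d} (Set.Icc c d) := fun p hp => hp
    have e₀ := h₀.comp (continuous_snd (X := unitInterval)).continuousOn hm
    have e₁ := h₁.comp (continuous_snd (X := unitInterval)).continuousOn hm
    have es : Continuous fun p : unitInterval × ℝ => (p.1 : ℝ) :=
      continuous_subtype_val.comp continuous_fst
    refine ContinuousOn.congr ((continuous_chartPoint K).comp_continuousOn
      ((((continuous_const (y := (1 : ℝ))).sub es).continuousOn.smul e₀).add (es.continuousOn.smul e₁))) ?_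
    intro p hp
    simp only [hh, if_pos (show p.2 ∈ Set.Icc c d from hp)]
    rfl
  have hcB : ContinuousOn h {p : unitInterval × ℝ | p.2 ∉ Set.Ioo c d} :=
    (Γ.continuous.comp continuous_snd).continuousOn.congr fun p hp => hoff p hp
  have hcont : Continuous h := by
    rw [← continuousOn_univ]
    refine (hcA.union_of_isClosed hcB hA hB).mono fun p _ => ?_
    by_cases hp : p.2 ∈ Set.Ioo c d
    · exact Or.inl (Set.Ioo_subset_Icc_self hp)
    · exact Or.inr hp
  refine ⟨⟨fun u => h (1, u), hcont.comp (by fun_prop)⟩, fun u hu => hoff (1, u) hu, ?_, ?_⟩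
  · intro u hu
    simp only [ContinuousMap.coe_mk, hh, if_pos hu, Set.Icc.coe_one, sub_self, zero_smul, zero_add,
      one_smul]
    exact chartPoint_val K (hs₁ u hu)
  · refine ⟨{ toFun := h, continuous_toFun := hcont, map_zero_left := fun u => ?_,
              map_one_left := fun u => rfl, prop' := fun s u hu => hoff (s, u) hu }⟩
    by_cases hu : u ∈ Set.Icc c d
    · simp only [hh, if_pos hu, Set.Icc.coe_zero, sub_zero, zero_smul, add_zero, one_smul]
      exact Subtype.ext ((chartPoint_val K (hs₀ u hu)).trans (hΓ u hu).symm)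
    · simp only [hh, if_neg hu]

/-! #### The model path -/

/-- Distinct points of `(1/3, 2/3)`. -/
def node (i : Fin n) : ℝ := 1 / 3 + ((i : ℝ) + 1) / (3 * ((n : ℝ) + 1))

lemma node_mem (i : Fin n) : node i ∈ Set.Ioo (1 / 3 : ℝ) (2 / 3) := by
  have h1 : (0 : ℝ) < 3 * ((n : ℝ) + 1) := by positivity
  have h2 : (i : ℝ) < n := by exact_mod_cast i.2
  refine ⟨?_, ?_⟩
  · have : 0 < ((i : ℝ) + 1) / (3 * ((n : ℝ) + 1)) := by positivity
    simp only [node]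
    linarith
  · have : ((i : ℝ) + 1) / (3 * ((n : ℝ) + 1)) < 1 / 3 := by
      rw [div_lt_iff₀ h1]
      linarith
    simp only [node]
    linarith

lemma node_injective : Function.Injective (node : Fin n → ℝ) := by
  intro i j h
  have h1 : (3 * ((n : ℝ) + 1)) ≠ 0 := by positivity
  simp only [node, add_right_inj, div_left_inj' h1, add_left_inj, Nat.cast_inj] at h
  exact Fin.ext h

/-- Diagonal entries indexed by `K`, decreasing through zero at the times `node i`. -/
def modelDiag (K : Finset (Fin n)) (r : ℝ) (i : Fin n) : ℝ :=
  if i ∈ K then r * (1 - r) * (node i - r) else 0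

/-- A path from `A` to `B` which is diagonal during `[1/3, 2/3]`. -/
def modelPath (K : Finset (Fin n)) (A B : Matrix (Fin n) (Fin n) ℝ) (r : ℝ) :
    Matrix (Fin n) (Fin n) ℝ :=
  max 0 (1 - 3 * r) • A + max 0 (3 * r - 2) • B + Matrix.diagonal (modelDiag K r)

lemma modelPath_zero (K : Finset (Fin n)) (A B : Matrix (Fin n) (Fin n) ℝ) :
    modelPath K A B 0 = A := by
  have : modelDiag K 0 = 0 := by ext i; simp [modelDiag]
  simp [modelPath, this]

lemma modelPath_one (K : Finset (Fin n)) (A B : Matrix (Fin n) (Fin n) ℝ) :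
    modelPath K A B 1 = B := by
  have h : modelDiag K 1 = 0 := by ext i; simp [modelDiag]
  have h1 : max (0 : ℝ) (1 - 3 * 1) = 0 := by norm_num
  have h2 : max (0 : ℝ) (3 * 1 - 2) = 1 := by norm_num
  rw [modelPath, h, h1, h2]
  simp

lemma modelPath_of_mem {K : Finset (Fin n)} {A B : Matrix (Fin n) (Fin n) ℝ} {r : ℝ}
    (hr : r ∈ Set.Icc (1 / 3 : ℝ) (2 / 3)) :
    modelPath K A B r = Matrix.diagonal (modelDiag K r) := by
  have h1 : max (0 : ℝ) (1 - 3 * r) = 0 := max_eq_left (by linarith [hr.1])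
  have h2 : max (0 : ℝ) (3 * r - 2) = 0 := max_eq_left (by linarith [hr.2])
  simp [modelPath, h1, h2]

lemma continuous_modelPath (K : Finset (Fin n)) (A B : Matrix (Fin n) (Fin n) ℝ) :
    Continuous (modelPath K A B) := by
  have h : Continuous (modelDiag K) := by
    refine continuous_pi fun i => ?_
    by_cases hi : i ∈ K <;> simp only [modelDiag, hi, if_true, if_false] <;> fun_prop
  have h1 : Continuous fun r : ℝ => max 0 (1 - 3 * r) := by fun_prop
  have h2 : Continuous fun r : ℝ => max 0 (3 * r - 2) := by fun_prop
  exact ((h1.smul continuous_const).add (h2.smul continuous_const)).add h.matrix_diagonal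

lemma isSymm_modelPath {K : Finset (Fin n)} {A B : Matrix (Fin n) (Fin n) ℝ} (hA : A.IsSymm)
    (hB : B.IsSymm) (r : ℝ) : (modelPath K A B r).IsSymm := by
  simp [Matrix.IsSymm, modelPath, Matrix.transpose_add, hA.eq, hB.eq]

lemma posOn_diagonal {K : Finset (Fin n)} {δ : Fin n → ℝ} (h : ∀ i ∈ K, 0 < δ i) :
    PosOn K (Matrix.diagonal δ) := by
  intro y hy hne
  obtain ⟨i, hi⟩ := Function.ne_iff.1 hne
  have hiK : i ∈ K := by
    by_contra hcon
    exact hi (hy i hcon)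
  refine Finset.sum_pos' (fun j _ => ?_) ⟨i, Finset.mem_univ i, ?_⟩
  · rw [Matrix.mulVec_diagonal]
    by_cases hj : j ∈ K
    · have := mul_nonneg (h j hj).le (mul_self_nonneg (y j))
      linarith
    · simp [hy j hj]
  · rw [Matrix.mulVec_diagonal]
    have := mul_pos (h i hiK) (mul_self_pos.2 hi)
    linarith

lemma PosOn.smul_add {K : Finset (Fin n)} {A B : Matrix (Fin n) (Fin n) ℝ} {α : ℝ}
    (hA : PosOn K A) (hB : PosOn K B) (hα : 0 ≤ α) : PosOn K (α • A + B) := by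
  intro y hy hne
  rw [Matrix.add_mulVec, dotProduct_add, Matrix.smul_mulVec, dotProduct_smul, smul_eq_mul]
  have := mul_nonneg hα (hA y hy hne).le
  have := hB y hy hne
  linarith

/-- All nodes lie beyond `1/3`, so for `0 < r ≤ 1/3` the diagonal part is positive on `K` and `A`
can be faded out without a crossing. The factor `r (1 - r)` in `modelDiag` makes the path begin
exactly at `A` and end at `B`. -/
lemma posOn_modelPath {K : Finset (Fin n)} {A B : Matrix (Fin n) (Fin n) ℝ} (hA : PosOn K A)
    {r : ℝ} (h0 : 0 ≤ r) (hr : r ≤ 1 / 3) : PosOn K (modelPath K A B r) := by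
  rcases h0.eq_or_lt with rfl | h0
  · rwa [modelPath_zero]
  · have h2 : max (0 : ℝ) (3 * r - 2) = 0 := max_eq_left (by linarith)
    rw [modelPath, h2, zero_smul, add_zero]
    refine hA.smul_add (posOn_diagonal fun i hi => ?_) (le_max_left _ _)
    have := (node_mem i).1
    simp only [modelDiag, hi, if_true]
    exact mul_pos (mul_pos h0 (by linarith)) (by linarith)

lemma posOn_neg_modelPath {K : Finset (Fin n)} {A B : Matrix (Fin n) (Fin n) ℝ}
    (hB : PosOn K (-B)) {r : ℝ} (h1 : r ≤ 1) (hr : 2 / 3 ≤ r) :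
    PosOn K (-modelPath K A B r) := by
  rcases h1.eq_or_lt with rfl | h1
  · rwa [modelPath_one]
  · have h2 : max (0 : ℝ) (1 - 3 * r) = 0 := max_eq_left (by linarith)
    rw [modelPath, h2, zero_smul, zero_add, neg_add, ← smul_neg, Matrix.diagonal_neg]
    refine hB.smul_add (posOn_diagonal fun i hi => ?_) (le_max_left _ _)
    have := (node_mem i).2
    simp only [modelDiag, hi, if_true]
    have := mul_pos (mul_pos (by linarith : 0 < r) (by linarith : 0 < 1 - r))
      (by linarith : 0 < r - node i)
    linarith

lemma modelDiag_ne_zero {K : Finset (Fin n)} {r : ℝ} (hr : r ∈ Set.Icc (1 / 3 : ℝ) (2 / 3))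
    {i : Fin n} (hi : i ∈ K) (h : r ≠ node i) : modelDiag K r i ≠ 0 := by
  simp only [modelDiag, hi, if_true]
  exact mul_ne_zero (mul_ne_zero (by linarith [hr.1]) (by linarith [hr.2])) (sub_ne_zero.2 h.symm)

lemma interDim_modelPath_eq_zero {K : Finset (Fin n)} {A B : Matrix (Fin n) (Fin n) ℝ}
    (hA : PosOn K A) (hB : PosOn K (-B)) {r : ℝ} (hr : r ∈ Set.Icc (0 : ℝ) 1)
    (h : ∀ i ∈ K, r ≠ node i) : interDim (chart K (modelPath K A B r)) = 0 := by
  rcases le_total r (1 / 3) with h1 | h1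
  · exact interDim_chart_of_posOn (Or.inl (posOn_modelPath hA hr.1 h1))
  rcases le_total (2 / 3) r with h2 | h2
  · exact interDim_chart_of_posOn (Or.inr (posOn_neg_modelPath hB hr.2 h2))
  rw [modelPath_of_mem ⟨h1, h2⟩]
  refine interDim_chart_eq_zero fun y hy hSy => ?_
  ext i
  by_cases hi : i ∈ K
  · have := hSy i hi
    rw [Matrix.mulVec_diagonal] at this
    exact (mul_eq_zero.1 this).resolve_left (modelDiag_ne_zero ⟨h1, h2⟩ hi (h i hi))
  · exact hy i hi

/-- The coordinates of the diagonal part of the model path in the chart `φ_{κ}`. -/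
def modelDiagAt (K : Finset (Fin n)) (κ : Fin n) (r : ℝ) (i : Fin n) : ℝ :=
  if i ∈ K ∧ i ∉ ({κ} : Finset (Fin n)) then -(modelDiag K r i)⁻¹ else modelDiag K r i

/-- The nodes are distinct, so near `node κ` only the entry `κ` vanishes; inverting the others moves
the path into the one-index chart that `SimpleCrossing` asks for. -/
lemma chart_modelPath_eventuallyEq {K : Finset (Fin n)} {κ : Fin n} (hκ : κ ∈ K)
    (A B : Matrix (Fin n) (Fin n) ℝ) :
    ∀ᶠ r in 𝓝 (node κ), chart K (modelPath K A B r) =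
      chart {κ} (Matrix.diagonal (modelDiagAt K κ r)) := by
  have h1 : ∀ᶠ r in 𝓝 (node κ), ∀ i, i ≠ κ → r ≠ node i := by
    rw [Filter.eventually_all]
    intro i
    by_cases hi : i = κ
    · exact Filter.Eventually.of_forall fun r h => absurd hi h
    · filter_upwards [isOpen_ne.mem_nhds (fun h => hi (node_injective h).symm :
        node κ ≠ node i)] with r hr _ using hr
  filter_upwards [h1, Ioo_mem_nhds (node_mem κ).1 (node_mem κ).2] with r hr hrI
  have hrI' := Set.Ioo_subset_Icc_self hrI
  rw [modelPath_of_mem hrI', chart_diagonal_eq (Finset.singleton_subset_iff.2 hκ)]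
  · rfl
  · intro i hi hiκ
    exact modelDiag_ne_zero hrI' hi (hr i (by simpa using hiκ))

/-- At `r = node i` only `-r (1 - r) < 0` remains: each entry crosses zero downwards. -/
lemma hasDerivAt_modelDiag {K : Finset (Fin n)} {i : Fin n} (hi : i ∈ K) (r : ℝ) :
    HasDerivAt (fun r => modelDiag K r i)
      ((1 - 2 * r) * (node i - r) - r * (1 - r)) r := by
  simp only [modelDiag, hi, if_true]
  have h := (((hasDerivAt_id r).mul ((hasDerivAt_const r (1 : ℝ)).sub (hasDerivAt_id r))).mul
    ((hasDerivAt_const r (node i)).sub (hasDerivAt_id r)))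
  refine h.congr_deriv ?_
  simp
  ring

lemma differentiableAt_modelDiagAt {K : Finset (Fin n)} {κ : Fin n} (i : Fin n) :
    DifferentiableAt ℝ (fun r => modelDiagAt K κ r i) (node κ) := by
  have h : DifferentiableAt ℝ (fun r => modelDiag K r i) (node κ) := by
    by_cases hi : i ∈ K
    · exact (hasDerivAt_modelDiag hi _).differentiableAt
    · simp [modelDiag, hi]
  by_cases hi : i ∈ K ∧ i ∉ ({κ} : Finset (Fin n))
  · simp only [modelDiagAt, if_pos hi]
    refine (h.inv ?_).neg
    refine modelDiag_ne_zero (Set.Ioo_subset_Icc_self (node_mem κ)) hi.1 fun h => ?_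
    exact hi.2 (by simp [node_injective h])
  · simpa only [modelDiagAt, if_neg hi] using h

/-! #### Simple and degenerate crossings -/

/-- The curve crosses the Maslov cycle transversally, in the negative direction. -/
def SimpleCrossing (Γ : ℝ → LagrangianGrassmannian n) (t : ℝ) : Prop :=
  interDim (Γ t).1 = 1 ∧
  ∃ (κ : Fin n) (S : ℝ → Matrix (Fin n) (Fin n) ℝ) (S' : Matrix (Fin n) (Fin n) ℝ),
    (∀ᶠ u in 𝓝 t, (S u).IsSymm ∧ (Γ u).1 = chart {κ} (S u)) ∧
    (∀ i j, HasDerivAt (fun u => S u i j) (S' i j) t) ∧ S' κ κ < 0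

/-- The curve meets the Maslov cycle at an isolated time, with negative definite crossing form. -/
def DegenerateCrossing (Γ : ℝ → LagrangianGrassmannian n) (t : ℝ) : Prop :=
  ∃ (K : Finset (Fin n)) (S : ℝ → Matrix (Fin n) (Fin n) ℝ), K.card = interDim (Γ t).1 ∧
    (∀ᶠ u in 𝓝 t, (S u).IsSymm ∧ (Γ u).1 = chart K (S u) ∧ ContinuousAt S u) ∧
    (∀ᶠ u in 𝓝[<] t, PosOn K (S u)) ∧ ∀ᶠ u in 𝓝[>] t, PosOn K (-S u)

lemma SimpleCrossing.congr {Γ Η : ℝ → LagrangianGrassmannian n} {t : ℝ} (h : SimpleCrossing Γ t)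
    (he : Γ =ᶠ[𝓝 t] Η) : SimpleCrossing Η t := by
  obtain ⟨h1, κ, S, S', hS, hS', hκ⟩ := h
  refine ⟨he.self_of_nhds ▸ h1, κ, S, S', ?_, hS', hκ⟩
  filter_upwards [hS, he] with u hu hu'
  rwa [← hu']

lemma DegenerateCrossing.congr {Γ Η : ℝ → LagrangianGrassmannian n} {t : ℝ}
    (h : DegenerateCrossing Γ t) (he : Γ =ᶠ[𝓝 t] Η) : DegenerateCrossing Η t := by
  obtain ⟨K, S, h1, hS, hl, hr⟩ := h
  refine ⟨K, S, he.self_of_nhds ▸ h1, ?_, hl, hr⟩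
  filter_upwards [hS, he] with u hu hu'
  rwa [← hu']

/-- A degenerate crossing may be replaced by simple crossings in an arbitrarily small
neighbourhood. -/
theorem DegenerateCrossing.exists_resolution {Γ : C(ℝ, LagrangianGrassmannian n)} {t : ℝ}
    (h : DegenerateCrossing Γ t) {U : Set ℝ} (hU : U ∈ 𝓝 t) :
    ∃ (c d : ℝ) (Η : C(ℝ, LagrangianGrassmannian n)) (T : Finset ℝ), t ∈ Set.Ioo c d ∧
      Set.Icc c d ⊆ U ∧ (∀ u ∉ Set.Ioo c d, Η u = Γ u) ∧ Γ.HomotopicRel Η (Set.Ioo c d)ᶜ ∧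
      T.card = interDim (Γ t).1 ∧ (∀ u ∈ T, u ∈ Set.Ioo c d) ∧
      (∀ u ∈ Set.Icc c d, interDim (Η u).1 ≠ 0 ↔ u ∈ T) ∧ ∀ u ∈ T, SimpleCrossing Η u := by
  obtain ⟨K, S, hK, hS, hl, hr⟩ := h
  have hev : ∀ᶠ u in 𝓝 t, u ∈ U ∧ ((S u).IsSymm ∧ (Γ u).1 = chart K (S u) ∧ ContinuousAt S u) ∧
      (u < t → PosOn K (S u)) ∧ (t < u → PosOn K (-S u)) := by
    filter_upwards [hU, hS, eventually_nhdsWithin_iff.1 hl, eventually_nhdsWithin_iff.1 hr]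
      with u h1 h2 h3 h4 using ⟨h1, h2, h3, h4⟩
  -- On `[t - ε, t + ε]` the chart is valid and the signs hold on both sides of `t`; the replacement
  -- path only needs the signs at the two ends.
  obtain ⟨ε, hε, hball⟩ := Metric.nhds_basis_closedBall.eventually_iff.1 hev
  rw [Real.closedBall_eq_Icc] at hball
  set c := t - ε with hc
  set d := t + ε with hd
  have hcd : c < d := by linarith
  have hdc : 0 < d - c := by linarith
  have hpos : PosOn K (S c) := (hball (Set.left_mem_Icc.2 hcd.le)).2.2.1 (by linarith)
  have hneg : PosOn K (-S d) := (hball (Set.right_mem_Icc.2 hcd.le)).2.2.2 (by linarith)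
  have hsc := (hball (Set.left_mem_Icc.2 hcd.le)).2.1.1
  have hsd := (hball (Set.right_mem_Icc.2 hcd.le)).2.1.1
  -- Affine change of time from `[c, d]` to `[0, 1]`; the crossings will be at `c + node i * (d -
  -- c)`, one for each `i ∈ K`.
  set ρ : ℝ → ℝ := fun u => (u - c) / (d - c) with hρ
  have hρcont : Continuous ρ := by fun_prop
  have hρderiv : ∀ u, HasDerivAt ρ (d - c)⁻¹ u := fun u => by
    have := ((hasDerivAt_id u).sub_const c).div_const (d - c)
    rwa [one_div] at this
  have hρmem : ∀ u ∈ Set.Icc c d, ρ u ∈ Set.Icc (0 : ℝ) 1 := fun u hu =>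
    ⟨div_nonneg (by linarith [hu.1]) hdc.le, (div_le_one hdc).2 (by linarith [hu.2])⟩
  have hρeq : ∀ u r, ρ u = r ↔ u = c + r * (d - c) := fun u r => by
    rw [hρ, div_eq_iff hdc.ne']
    constructor <;> intro h <;> linarith
  obtain ⟨Η, hΗ1, hΗ2, hΗ3⟩ := exists_replacement Γ hcd.le (K := K) (S₀ := S)
    (S₁ := fun u => modelPath K (S c) (S d) (ρ u))
    (fun u hu => (hball hu).2.1.2.2.continuousWithinAt)
    ((continuous_modelPath K _ _).comp hρcont).continuousOn (fun u hu => (hball hu).2.1.1)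
    (fun u _ => isSymm_modelPath hsc hsd _)
    (by simp only [(hρeq c 0).2 (by ring), modelPath_zero])
    (by simp only [(hρeq d 1).2 (by ring), modelPath_one]) (fun u hu => (hball hu).2.1.2.1)
  have hnode : ∀ i : Fin n, c + node i * (d - c) ∈ Set.Ioo c d := fun i => by
    have h1 := node_mem i
    have h2 : 0 < node i := by linarith [h1.1]
    have h3 : node i < 1 := by linarith [h1.2]
    exact ⟨by nlinarith, by nlinarith⟩
  have hTI : ∀ u ∈ K.image (fun i => c + node i * (d - c)), u ∈ Set.Ioo c d := by
    intro u hu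
    obtain ⟨i, -, rfl⟩ := Finset.mem_image.1 hu
    exact hnode i
  have hsimple : ∀ u ∈ K.image (fun i => c + node i * (d - c)), SimpleCrossing Η u := by
    intro u hu
    obtain ⟨κ, hκ, rfl⟩ := Finset.mem_image.1 hu
    have hρu : ρ (c + node κ * (d - c)) = node κ := (hρeq _ _).2 rfl
    have hchart : ∀ᶠ u in 𝓝 (c + node κ * (d - c)),
        (Η u).1 = chart {κ} (Matrix.diagonal (modelDiagAt K κ (ρ u))) := by
      have h1 : Filter.Tendsto ρ (𝓝 (c + node κ * (d - c))) (𝓝 (node κ)) := by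
        have := hρcont.tendsto (c + node κ * (d - c))
        rwa [hρu] at this
      filter_upwards [h1.eventually (chart_modelPath_eventuallyEq hκ (S c) (S d)),
        Ioo_mem_nhds (hnode κ).1 (hnode κ).2] with u hu1 hu2
      rw [hΗ2 u (Set.Ioo_subset_Icc_self hu2), hu1]
    refine ⟨?_, κ, fun u => Matrix.diagonal (modelDiagAt K κ (ρ u)),
      Matrix.diagonal fun i => deriv (fun r => modelDiagAt K κ r i) (node κ) * (d - c)⁻¹, ?_, ?_, ?_⟩
    · rw [hchart.self_of_nhds]
      refine interDim_chart_singleton_eq_one ?_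
      rw [hρu]
      simp [modelDiagAt, modelDiag]
    · filter_upwards [hchart] with u hu
      exact ⟨Matrix.diagonal_transpose _, hu⟩
    · intro i j
      by_cases hij : i = j
      · subst hij
        simp only [Matrix.diagonal_apply_eq]
        have h2 := (differentiableAt_modelDiagAt (K := K) (κ := κ) i).hasDerivAt
        rw [← hρu] at h2
        have h3 := h2.comp (c + node κ * (d - c)) (hρderiv _)
        rwa [hρu] at h3
      · simp only [Matrix.diagonal_apply_ne _ hij]
        exact hasDerivAt_const _ _
    · have h2 : (fun r => modelDiagAt K κ r κ) = fun r => modelDiag K r κ := by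
        ext r; simp [modelDiagAt]
      rw [Matrix.diagonal_apply_eq, h2, (hasDerivAt_modelDiag hκ _).deriv, sub_self, mul_zero,
        zero_sub]
      have h3 := node_mem κ
      have h4 : 0 < node κ * (1 - node κ) := mul_pos (by linarith [h3.1]) (by linarith [h3.2])
      have h5 : 0 < (d - c)⁻¹ := inv_pos.2 hdc
      nlinarith [mul_pos h4 h5]
  refine ⟨c, d, Η, K.image (fun i => c + node i * (d - c)), ⟨by linarith, by linarith⟩,
    fun u hu => (hball hu).1, hΗ1, hΗ3, ?_, hTI, fun u hu => ⟨fun hne => ?_, fun hu' => ?_⟩,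
    hsimple⟩
  · rw [Finset.card_image_of_injective _ fun i j hij => ?_, hK]
    exact node_injective (mul_right_cancel₀ hdc.ne' (add_left_cancel hij))
  · by_contra hnot
    refine hne ?_
    rw [hΗ2 u hu]
    refine interDim_modelPath_eq_zero hpos hneg (hρmem u hu) fun i hi hcon => hnot ?_
    exact Finset.mem_image.2 ⟨i, hi, ((hρeq _ _).1 hcon).symm⟩
  · rw [(hsimple u hu').1]
    exact one_ne_zero

/-- A curve all of whose intersections with the Maslov cycle have negative definite crossing form
is homotopic to one with simple crossings only. -/
theorem exists_simple_representative {a b : ℝ} (G B : Finset ℝ) :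
    ∀ Γ : C(ℝ, LagrangianGrassmannian n), (∀ t ∈ G, t ∈ Set.Ioo a b) →
      (∀ t ∈ B, t ∈ Set.Ioo a b) → Disjoint G B →
      (∀ t ∈ Set.Icc a b, interDim (Γ t).1 ≠ 0 ↔ t ∈ G ∨ t ∈ B) →
      (∀ t ∈ G, SimpleCrossing Γ t) → (∀ t ∈ B, DegenerateCrossing Γ t) →
      ∃ (Η : C(ℝ, LagrangianGrassmannian n)) (T : Finset ℝ), (∀ t ∈ T, t ∈ Set.Ioo a b) ∧
        Γ.HomotopicRel Η (Set.Ioo a b)ᶜ ∧ (∀ t ∈ Set.Icc a b, interDim (Η t).1 ≠ 0 ↔ t ∈ T) ∧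
        (∀ t ∈ T, SimpleCrossing Η t) ∧ T.card = G.card + ∑ t ∈ B, interDim (Γ t).1 := by
  -- `G` is generalized because resolving `t₀` adds its new simple crossings to `G`. The interval
  -- used avoids all other crossings, near which the curve is unchanged.
  induction B using Finset.induction_on generalizing G with
  | empty =>
    intro Γ hG _ _ hΓ hs _
    exact ⟨Γ, G, hG, .refl Γ, by simpa using hΓ, hs, by simp⟩
  | insert t₀ B ht₀ ih =>
    intro Γ hG hB hdisj hΓ hs hdeg
    rw [Finset.disjoint_insert_right] at hdisj
    have ht₀I := hB t₀ (Finset.mem_insert_self _ _)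
    have hU : Set.Ioo a b ∩ {u | u ∉ G ∪ B} ∈ 𝓝 t₀ :=
      Filter.inter_mem (Ioo_mem_nhds ht₀I.1 ht₀I.2)
        ((G ∪ B).finite_toSet.isClosed.isOpen_compl.mem_nhds (by simp [hdisj.1, ht₀]))
    obtain ⟨c, d, Η, T, htcd, hcdU, hΗ1, hΗ2, hTc, hTI, hT, hTs⟩ :=
      (hdeg t₀ (Finset.mem_insert_self _ _)).exists_resolution hU
    have hIoo : Set.Ioo c d ⊆ Set.Ioo a b := fun u hu => (hcdU (Set.Ioo_subset_Icc_self hu)).1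
    have hout : ∀ t, t ∈ G ∪ B → t ∉ Set.Icc c d := fun t ht hcon => (hcdU hcon).2 ht
    have hgerm : ∀ t, t ∈ G ∪ B → (Γ : ℝ → LagrangianGrassmannian n) =ᶠ[𝓝 t] Η := fun t ht => by
      filter_upwards [isClosed_Icc.isOpen_compl.mem_nhds (hout t ht)] with u hu
      exact (hΗ1 u fun hcon => hu (Set.Ioo_subset_Icc_self hcon)).symm
    have hGT : Disjoint G T := Finset.disjoint_left.2 fun t htG htT =>
      hout t (Finset.mem_union_left _ htG) (Set.Ioo_subset_Icc_self (hTI t htT))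
    have hBT : Disjoint T B := Finset.disjoint_left.2 fun t htT htB =>
      hout t (Finset.mem_union_right _ htB) (Set.Ioo_subset_Icc_self (hTI t htT))
    have hG' : ∀ t ∈ G ∪ T, t ∈ Set.Ioo a b := by
      intro t ht
      rcases Finset.mem_union.1 ht with ht | ht
      · exact hG t ht
      · exact hIoo (hTI t ht)
    have hΗ : ∀ t ∈ Set.Icc a b, interDim (Η t).1 ≠ 0 ↔ t ∈ G ∪ T ∨ t ∈ B := by
      intro t ht
      by_cases hcd : t ∈ Set.Icc c d
      · have hn : t ∉ G ∪ B := fun hcon => hout t hcon hcd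
        rw [Finset.mem_union, not_or] at hn
        rw [hT t hcd, Finset.mem_union]
        simp [hn.1, hn.2]
      · have hn : t ∉ T := fun hcon => hcd (Set.Ioo_subset_Icc_self (hTI t hcon))
        have hne : t ≠ t₀ := fun hcon => hcd (hcon ▸ Set.Ioo_subset_Icc_self htcd)
        rw [hΗ1 t fun hcon => hcd (Set.Ioo_subset_Icc_self hcon), hΓ t ht, Finset.mem_union,
          Finset.mem_insert]
        simp [hn, hne]
    have hs' : ∀ t ∈ G ∪ T, SimpleCrossing Η t := by
      intro t ht
      rcases Finset.mem_union.1 ht with ht | ht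
      · exact (hs t ht).congr (hgerm t (Finset.mem_union_left _ ht))
      · exact hTs t ht
    obtain ⟨Η', T', h1, h2, h3, h4, h5⟩ := ih (G ∪ T) Η hG'
      (fun t ht => hB t (Finset.mem_insert_of_mem ht))
      (Finset.disjoint_union_left.2 ⟨hdisj.2, hBT⟩) hΗ hs'
      (fun t ht => (hdeg t (Finset.mem_insert_of_mem ht)).congr
        (hgerm t (Finset.mem_union_right _ ht)))
    refine ⟨Η', T', h1, (homotopicRel_mono hΗ2 (Set.compl_subset_compl.2 hIoo)).trans h2, h3, h4,
      ?_⟩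
    rw [h5, Finset.card_union_of_disjoint hGT, Finset.sum_insert ht₀, hTc, add_assoc]
    congr 2
    refine Finset.sum_congr rfl fun t ht => ?_
    rw [(hgerm t (Finset.mem_union_right _ ht)).self_of_nhds]

/-! ### The flow of the linear system -/

lemma IsFrame.finrank_eq {L : Submodule ℝ (PhaseSpace n)}
    {Z : Matrix (Fin n ⊕ Fin n) (Fin n) ℝ} (h : IsFrame L Z) : Module.finrank ℝ L = n := by
  let f : (Fin n → ℝ) →ₗ[ℝ] L :=
    { toFun := fun c => ⟨WithLp.toLp 2 (Z.mulVec c), (h.1 _).2 ⟨c, rfl⟩⟩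
      map_add' := fun c d => by
        refine Subtype.ext ?_
        change WithLp.toLp 2 _ = WithLp.toLp 2 _ + WithLp.toLp 2 _
        rw [Matrix.mulVec_add, WithLp.toLp_add]
      map_smul' := fun r c => by
        refine Subtype.ext ?_
        change WithLp.toLp 2 _ = r • WithLp.toLp 2 _
        rw [Matrix.mulVec_smul, WithLp.toLp_smul] }
  have hf : Function.Bijective f := by
    constructor
    · rw [← LinearMap.ker_eq_bot, LinearMap.ker_eq_bot']
      intro c hc
      exact h.2 c (congrArg (fun x : L => x.1.ofLp) hc)
    · rintro ⟨x, hx⟩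
      obtain ⟨c, hc⟩ := (h.1 x).1 hx
      exact ⟨c, Subtype.ext (WithLp.ofLp_injective 2 hc)⟩
  rw [← (LinearEquiv.ofBijective f hf).finrank_eq]
  simp

section Flow

variable {R : ℝ → Matrix (Fin n) (Fin n) ℝ} {a b : ℝ}

lemma continuousOn_system (hR : ContinuousOn R (Set.Icc a b)) :
    ContinuousOn (fun t => Matrix.toEuclideanCLM (n := Fin n ⊕ Fin n) (𝕜 := ℝ)
      (systemMatrix (R t))) (Set.Icc a b) := by
  have h2 : Continuous (Matrix.toEuclideanCLM (n := Fin n ⊕ Fin n) (𝕜 := ℝ)) :=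
    LinearMap.continuous_of_finiteDimensional
      ((Matrix.toEuclideanCLM (n := Fin n ⊕ Fin n) (𝕜 := ℝ)).toAlgEquiv.toLinearMap)
  have h3 : Continuous (systemMatrix : Matrix (Fin n) (Fin n) ℝ → _) :=
    Continuous.matrix_fromBlocks continuous_const continuous_const continuous_id continuous_const
  exact (h2.comp h3).comp_continuousOn hR

lemma isSolution_sum {v : Fin n → ℝ → PhaseSpace n} (hv : ∀ j, IsSolution R a b (v j))
    (c : Fin n → ℝ) : IsSolution R a b fun u => ∑ j, c j • v j u := by
  intro t ht
  have h := HasDerivWithinAt.fun_sum (u := Finset.univ)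
    fun j _ => (hv j t ht).fun_const_smul (c j)
  simpa only [map_sum, map_smul] using h

lemma IsSolution.sub {v w : ℝ → PhaseSpace n} (hv : IsSolution R a b v)
    (hw : IsSolution R a b w) : IsSolution R a b fun u => v u - w u := by
  intro t ht
  simpa only [map_sub] using (hv t ht).fun_sub (hw t ht)

lemma IsSolution.eq_zero (hR : ContinuousOn R (Set.Icc a b)) {v : ℝ → PhaseSpace n}
    (hv : IsSolution R a b v) {t₀ : ℝ} (ht₀ : t₀ ∈ Set.Icc a b) (h0 : v t₀ = 0) :
    ∀ t ∈ Set.Icc a b, v t = 0 :=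
  linear_solution_eq_zero (continuousOn_system hR) hv ht₀ h0

/-- The Lagrangians of the flow have a frame consisting of solutions. -/
lemma exists_flow_frame (hab : a ≤ b) (hR : ContinuousOn R (Set.Icc a b))
    {τ : Submodule ℝ (PhaseSpace n)} (hτ : IsLagrangian τ) :
    ∃ v : Fin n → ℝ → PhaseSpace n, (∀ j, IsSolution R a b (v j)) ∧
      ∀ u ∈ Set.Icc a b, IsFrame (flow R a b τ u) (Matrix.of fun i j => v j u i) := by
  let e : Module.Basis (Fin n) ℝ τ := Module.finBasisOfFinrankEq ℝ τ hτ.2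
  have hex : ∀ j, ∃ v : ℝ → PhaseSpace n, v a = e j ∧ IsSolution R a b v := fun j =>
    exists_linear_solution hab (continuousOn_system hR) (e j : PhaseSpace n)
  choose v hva hv using hex
  have haI : a ∈ Set.Icc a b := Set.left_mem_Icc.2 hab
  have hmul : ∀ (c : Fin n → ℝ) u, (Matrix.of fun i j => v j u i).mulVec c =
      (∑ j, c j • v j u : PhaseSpace n) := fun c u => by
    ext i
    simp [Matrix.mulVec, dotProduct, mul_comm]
  refine ⟨v, hv, fun u hu => ⟨fun x => ⟨?_, ?_⟩, fun c hc => ?_⟩⟩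
  · rintro ⟨w, hw, hws, rfl⟩
    refine ⟨e.repr ⟨w a, hw⟩, ?_⟩
    -- A solution starting in `τ` agrees at time `a` with a combination of the `v j`, hence
    -- throughout by uniqueness.
    have h := (hws.sub (isSolution_sum hv (e.repr ⟨w a, hw⟩))).eq_zero hR haI (by
      have := congrArg Subtype.val (e.sum_repr ⟨w a, hw⟩)
      rw [Submodule.coe_sum] at this
      simp only [Submodule.coe_smul] at this
      simp only [hva, this, sub_self]) u hu
    rw [hmul, ← sub_eq_zero.1 h]
  · rintro ⟨c, hc⟩
    rw [hmul] at hc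
    refine ⟨fun u => ∑ j, c j • v j u, ?_, isSolution_sum hv c, WithLp.ofLp_injective 2 hc⟩
    exact Submodule.sum_mem _ fun j _ => Submodule.smul_mem _ _ (hva j ▸ (e j).2)
  · rw [hmul] at hc
    -- A linear relation at time `u` propagates back to time `a`, where the `v j` form a basis of
    -- `τ`.
    have h := (isSolution_sum hv c).eq_zero hR hu (WithLp.ofLp_injective 2 hc) a haI
    simp only [hva] at h
    have h2 : ∑ j, c j • e j = 0 := by
      refine Subtype.ext ?_
      rw [Submodule.coe_sum]
      exact h
    ext j
    exact Fintype.linearIndependent_iff.1 e.linearIndependent c h2 j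

lemma IsSolution.hasDerivWithinAt_inl {v : ℝ → PhaseSpace n} (hv : IsSolution R a b v) {t : ℝ}
    (ht : t ∈ Set.Icc a b) (i : Fin n) :
    HasDerivWithinAt (fun u => v u (Sum.inl i)) (v t (Sum.inr i)) (Set.Icc a b) t := by
  have h := (hasDerivWithinAt_pi.1 ((PiLp.continuousLinearEquiv 2 ℝ
    (fun _ : Fin n ⊕ Fin n => ℝ)).toContinuousLinearMap.hasFDerivAt.comp_hasDerivWithinAt t
      (hv t ht))) (Sum.inl i)
  refine h.congr_deriv ?_
  change (systemMatrix (R t)).mulVec (v t) (Sum.inl i) = _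
  simp [systemMatrix, Matrix.fromBlocks_mulVec]

lemma IsSolution.hasDerivWithinAt_inr {v : ℝ → PhaseSpace n} (hv : IsSolution R a b v) {t : ℝ}
    (ht : t ∈ Set.Icc a b) (i : Fin n) :
    HasDerivWithinAt (fun u => v u (Sum.inr i)) (∑ j, R t i j * v t (Sum.inl j))
      (Set.Icc a b) t := by
  have h := (hasDerivWithinAt_pi.1 ((PiLp.continuousLinearEquiv 2 ℝ
    (fun _ : Fin n ⊕ Fin n => ℝ)).toContinuousLinearMap.hasFDerivAt.comp_hasDerivWithinAt t
      (hv t ht))) (Sum.inr i)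
  refine h.congr_deriv ?_
  change (systemMatrix (R t)).mulVec (v t) (Sum.inr i) = _
  simp [systemMatrix, Matrix.mulVec, dotProduct]

/-- The flow is symplectic. -/
lemma omega_const (hR : ∀ t ∈ Set.Icc a b, (R t).IsSymm) {v w : ℝ → PhaseSpace n}
    (hv : IsSolution R a b v) (hw : IsSolution R a b w) :
    ∀ t ∈ Set.Icc a b, omega (v t) (w t) = omega (v a) (w a) := by
  have hd : ∀ t ∈ Set.Icc a b,
      HasDerivWithinAt (fun u => omega (v u) (w u)) 0 (Set.Icc a b) t := by
    intro t ht
    have h := HasDerivWithinAt.fun_sum (u := Finset.univ) fun (i : Fin n) _ =>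
      (((hv.hasDerivWithinAt_inl ht i).mul (hw.hasDerivWithinAt_inr ht i)).neg.add
        ((hv.hasDerivWithinAt_inr ht i).mul (hw.hasDerivWithinAt_inl ht i)))
    refine h.congr_deriv ?_
    -- The products of momenta cancel in the derivative of `ω`; the terms with `R` cancel by its
    -- symmetry.
    have hsymm : ∑ i, v t (Sum.inl i) * ∑ j, R t i j * w t (Sum.inl j) =
        ∑ i, (∑ j, R t i j * v t (Sum.inl j)) * w t (Sum.inl i) := by
      simp_rw [Finset.mul_sum, Finset.sum_mul]
      rw [Finset.sum_comm]
      refine Finset.sum_congr rfl fun i _ => Finset.sum_congr rfl fun j _ => ?_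
      rw [(hR t ht).apply i j]
      ring
    rw [Finset.sum_add_distrib, Finset.sum_neg_distrib, Finset.sum_add_distrib,
      Finset.sum_add_distrib, hsymm]
    ring
  exact constant_of_has_deriv_right_zero (fun t ht => (hd t ht).continuousWithinAt)
    fun t ht => hasDerivWithinAt_Ici_of_Icc ht (hd t (Set.Ico_subset_Icc_self ht))

lemma isLagrangian_flow (hab : a ≤ b) (hRc : ContinuousOn R (Set.Icc a b))
    (hR : ∀ t ∈ Set.Icc a b, (R t).IsSymm) {τ : Submodule ℝ (PhaseSpace n)}
    (hτ : IsLagrangian τ) {t : ℝ} (ht : t ∈ Set.Icc a b) : IsLagrangian (flow R a b τ t) := by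
  obtain ⟨v, -, hfr⟩ := exists_flow_frame hab hRc hτ
  refine ⟨?_, (hfr t ht).finrank_eq⟩
  rintro _ ⟨x, hx, hxs, rfl⟩ _ ⟨y, hy, hys, rfl⟩
  rw [omega_const hR hxs hys t ht, hτ.1 _ hx _ hy]

/-- The flow as a curve of Lagrangians, continued by constants outside `[a, b]`. -/
lemma exists_flow_curve (hab : a ≤ b) (hRc : ContinuousOn R (Set.Icc a b))
    (hR : ∀ t ∈ Set.Icc a b, (R t).IsSymm) {τ : Submodule ℝ (PhaseSpace n)}
    (hτ : IsLagrangian τ) :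
    ∃ Γ : C(ℝ, LagrangianGrassmannian n), ∀ t ∈ Set.Icc a b, (Γ t).1 = flow R a b τ t := by
  obtain ⟨v, hv, hfr⟩ := exists_flow_frame hab hRc hτ
  refine ⟨⟨fun u => ⟨flow R a b τ (Set.projIcc a b hab u),
    isLagrangian_flow hab hRc hR hτ (Set.projIcc a b hab u).2⟩, ?_⟩, fun t ht => ?_⟩
  · refine continuous_of_isFrame ?_ fun u => hfr _ (Set.projIcc a b hab u).2
    refine continuous_matrix fun i j => ?_
    have h : ContinuousOn (v j) (Set.Icc a b) := fun t ht => (hv j t ht).continuousWithinAt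
    have h2 : Continuous fun u => v j (Set.projIcc a b hab u) :=
      h.comp_continuous (continuous_subtype_val.comp continuous_projIcc)
        fun u => (Set.projIcc a b hab u).2
    exact (EuclideanSpace.proj (𝕜 := ℝ) i).continuous.comp h2
  · change flow R a b τ (Set.projIcc a b hab t) = _
    rw [Set.projIcc_of_mem hab ht]

end Flow

/-! ### The crossing form of the flow -/

/-- By Cauchy–Schwarz, `(∑ |y i|)² ≤ n |y|²`, so the entrywise error changes the form by at most `n
/ (2(n + 1)) |y|² < |y|²`; the `+ 1` keeps the bound meaningful for `n = 0`. -/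
lemma posOn_of_near {K : Finset (Fin n)} {M P : Matrix (Fin n) (Fin n) ℝ}
    (hP : ∀ y : Fin n → ℝ, (∀ i ∉ K, y i = 0) → y ⬝ᵥ y ≤ y ⬝ᵥ P.mulVec y)
    (hM : ∀ i j, |M i j - P i j| ≤ 1 / (2 * ((n : ℝ) + 1))) : PosOn K M := by
  intro y hy hne
  have hyy : 0 < y ⬝ᵥ y := by
    refine lt_of_le_of_ne (Finset.sum_nonneg fun i _ => mul_self_nonneg _) fun h => hne ?_
    exact dotProduct_self_eq_zero.1 h.symm
  have h1 : y ⬝ᵥ M.mulVec y = y ⬝ᵥ P.mulVec y + y ⬝ᵥ (M - P).mulVec y := by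
    rw [Matrix.sub_mulVec, dotProduct_sub]
    ring
  have h2 : |y ⬝ᵥ (M - P).mulVec y| ≤ 1 / (2 * ((n : ℝ) + 1)) * (∑ i, |y i|) ^ 2 := by
    rw [dotProduct]
    refine (Finset.abs_sum_le_sum_abs _ _).trans ?_
    rw [sq, Finset.sum_mul, Finset.mul_sum]
    refine Finset.sum_le_sum fun i _ => ?_
    rw [abs_mul, mul_left_comm]
    refine mul_le_mul_of_nonneg_left ?_ (abs_nonneg _)
    rw [Matrix.mulVec, dotProduct, Finset.mul_sum]
    refine (Finset.abs_sum_le_sum_abs _ _).trans (Finset.sum_le_sum fun j _ => ?_)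
    rw [abs_mul]
    exact mul_le_mul_of_nonneg_right (hM i j) (abs_nonneg _)
  have h3 : (∑ i, |y i|) ^ 2 ≤ n * (y ⬝ᵥ y) := by
    have := sq_sum_le_card_mul_sum_sq (s := Finset.univ) (f := fun i : Fin n => |y i|)
    simp only [Finset.card_univ, Fintype.card_fin, sq_abs] at this
    refine this.trans (le_of_eq ?_)
    simp only [dotProduct, sq]
  have hn : (0 : ℝ) ≤ n := Nat.cast_nonneg n
  have h4 : 1 / (2 * ((n : ℝ) + 1)) * (n * (y ⬝ᵥ y)) < y ⬝ᵥ y := by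
    rw [div_mul_eq_mul_div, one_mul, div_lt_iff₀ (by positivity)]
    nlinarith
  have h5 := mul_le_mul_of_nonneg_left h3 (by positivity : 0 ≤ 1 / (2 * ((n : ℝ) + 1)))
  have h6 := hP y hy
  have h7 := (abs_le.1 h2).1
  linarith

/-- A path of matrices whose `K`-block vanishes at `t` with negative definite derivative. -/
lemma eventually_posOn_of_hasDerivAt {K : Finset (Fin n)} {S : ℝ → Matrix (Fin n) (Fin n) ℝ}
    {S' : Matrix (Fin n) (Fin n) ℝ} {t : ℝ}
    (hS : ∀ i j, HasDerivAt (fun u => S u i j) (S' i j) t)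
    (h0 : ∀ i ∈ K, ∀ j ∈ K, S t i j = 0)
    (hS' : ∀ y : Fin n → ℝ, (∀ i ∉ K, y i = 0) → y ⬝ᵥ y ≤ y ⬝ᵥ (-S').mulVec y) :
    (∀ᶠ u in 𝓝[<] t, PosOn K (S u)) ∧ ∀ᶠ u in 𝓝[>] t, PosOn K (-S u) := by
  -- The negated difference quotient tends to `-S'`. As the `K`-block of `S t` vanishes, the sign of
  -- `u - t` then decides that of the form of `S u`.
  have hnear : ∀ᶠ u in 𝓝[≠] t, PosOn K ((-(u - t)⁻¹) • (S u - S t)) := by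
    have : ∀ᶠ u in 𝓝[≠] t, ∀ i j,
        |((-(u - t)⁻¹) • (S u - S t)) i j - (-S') i j| ≤ 1 / (2 * ((n : ℝ) + 1)) := by
      rw [Filter.eventually_all]
      intro i
      rw [Filter.eventually_all]
      intro j
      have h1 := (hasDerivAt_iff_tendsto_slope.1 (hS i j)).neg
      have h2 := Metric.tendsto_nhds.1 h1 (1 / (2 * ((n : ℝ) + 1))) (by positivity)
      filter_upwards [h2] with u hu
      rw [Real.dist_eq] at hu
      refine le_of_eq_of_le ?_ hu.le
      congr 1
      simp only [Matrix.smul_apply, Matrix.sub_apply, Matrix.neg_apply, smul_eq_mul,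
        slope_def_field]
      ring
    filter_upwards [this] with u hu using posOn_of_near hS' hu
  have hzero : ∀ y : Fin n → ℝ, (∀ i ∉ K, y i = 0) → y ⬝ᵥ (S t).mulVec y = 0 := by
    intro y hy
    refine Finset.sum_eq_zero fun i _ => ?_
    by_cases hi : i ∈ K
    · have : (S t).mulVec y i = 0 := by
        rw [Matrix.mulVec, dotProduct]
        refine Finset.sum_eq_zero fun j _ => ?_
        by_cases hj : j ∈ K
        · rw [h0 i hi j hj, zero_mul]
        · rw [hy j hj, mul_zero]
      rw [this, mul_zero]
    · rw [hy i hi, zero_mul]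
  have hform : ∀ u y, (∀ i ∉ K, y i = 0) →
      y ⬝ᵥ ((-(u - t)⁻¹) • (S u - S t)).mulVec y = -(u - t)⁻¹ * (y ⬝ᵥ (S u).mulVec y) := by
    intro u y hy
    rw [Matrix.smul_mulVec, dotProduct_smul, Matrix.sub_mulVec, dotProduct_sub, hzero y hy,
      sub_zero, smul_eq_mul]
  constructor
  · filter_upwards [hnear.filter_mono (nhdsWithin_mono t fun v hv => ne_of_lt hv),
      self_mem_nhdsWithin] with u hu hut y hy hne
    have h1 := hu y hy hne
    rw [hform u y hy] at h1
    have h2 : 0 < -(u - t)⁻¹ := neg_pos.2 (inv_lt_zero.2 (sub_neg.2 hut))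
    exact (mul_pos_iff_of_pos_left h2).1 h1
  · filter_upwards [hnear.filter_mono (nhdsWithin_mono t fun v hv => ne_of_gt hv),
      self_mem_nhdsWithin] with u hu hut y hy hne
    have h1 := hu y hy hne
    rw [hform u y hy] at h1
    have h2 : 0 < (u - t)⁻¹ := inv_pos.2 (sub_pos.2 hut)
    rw [Matrix.neg_mulVec, dotProduct_neg]
    rw [neg_mul, ← mul_neg] at h1
    exact (mul_pos_iff_of_pos_left h2).1 h1

/-- Where `f` vanishes the product rule needs only continuity of `g`. Applied to `Y X⁻¹ - S₀ = (Y -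
S₀ X) X⁻¹`, it avoids differentiating `X⁻¹`. -/
lemma hasDerivAt_mul_of_eq_zero {f g : ℝ → ℝ} {f' t : ℝ} (hf : HasDerivAt f f' t) (h0 : f t = 0)
    (hg : ContinuousAt g t) : HasDerivAt (fun u => f u * g u) (f' * g t) t := by
  rw [hasDerivAt_iff_tendsto_slope] at hf ⊢
  refine (hf.mul (hg.tendsto.mono_left nhdsWithin_le_nhds)).congr fun u => ?_
  simp only [slope_def_field, h0]
  ring

/-- Intersections of the flow with the Maslov cycle have negative definite crossing form. -/
theorem degenerateCrossing_flow {R : ℝ → Matrix (Fin n) (Fin n) ℝ} {a b : ℝ} (hab : a < b)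
    (hRc : ContinuousOn R (Set.Icc a b)) {τ : Submodule ℝ (PhaseSpace n)} (hτ : IsLagrangian τ)
    {Γ : C(ℝ, LagrangianGrassmannian n)} (hΓ : ∀ t ∈ Set.Icc a b, (Γ t).1 = flow R a b τ t)
    {t : ℝ} (ht : t ∈ Set.Ioo a b) : DegenerateCrossing Γ t := by
  obtain ⟨v, hv, hfr⟩ := exists_flow_frame hab.le hRc hτ
  obtain ⟨K, S₀, hS₀, hLS, hK, hKK⟩ := exists_adapted_chart (Γ t).2
  have hIcc : ∀ u ∈ Set.Ioo a b, u ∈ Set.Icc a b := fun u hu => Set.Ioo_subset_Icc_self hu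
  set X : ℝ → Matrix (Fin n) (Fin n) ℝ := fun u => Matrix.of fun i j => baseCoord K (v j u) i
    with hX
  set Y : ℝ → Matrix (Fin n) (Fin n) ℝ := fun u => Matrix.of fun i j => fibreCoord K (v j u) i
    with hY
  have hinl : ∀ u ∈ Set.Ioo a b, ∀ i j,
      HasDerivAt (fun u => v j u (Sum.inl i)) (v j u (Sum.inr i)) u := fun u hu i j =>
    ((hv j).hasDerivWithinAt_inl (hIcc u hu) i).hasDerivAt (Icc_mem_nhds hu.1 hu.2)
  have hinr : ∀ u ∈ Set.Ioo a b, ∀ i j, HasDerivAt (fun u => v j u (Sum.inr i))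
      (∑ l, R u i l * v j u (Sum.inl l)) u := fun u hu i j =>
    ((hv j).hasDerivWithinAt_inr (hIcc u hu) i).hasDerivAt (Icc_mem_nhds hu.1 hu.2)
  set X' : ℝ → Matrix (Fin n) (Fin n) ℝ := fun u => Matrix.of fun i j =>
    if i ∈ K then ∑ l, R u i l * v j u (Sum.inl l) else v j u (Sum.inr i) with hX'
  set Y' : ℝ → Matrix (Fin n) (Fin n) ℝ := fun u => Matrix.of fun i j =>
    if i ∈ K then -v j u (Sum.inr i) else ∑ l, R u i l * v j u (Sum.inl l) with hY'
  have hXd : ∀ u ∈ Set.Ioo a b, ∀ i j, HasDerivAt (fun u => X u i j) (X' u i j) u := by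
    intro u hu i j
    by_cases hi : i ∈ K
    · simpa [hX, hX', baseCoord_apply, hi] using hinr u hu i j
    · simpa [hX, hX', baseCoord_apply, hi] using hinl u hu i j
  have hYd : ∀ u ∈ Set.Ioo a b, ∀ i j, HasDerivAt (fun u => Y u i j) (Y' u i j) u := by
    intro u hu i j
    by_cases hi : i ∈ K
    · simpa [hY, hY', fibreCoord_apply, hi] using (hinl u hu i j).fun_neg
    · simpa [hY, hY', fibreCoord_apply, hi] using hinr u hu i j
  have hXc : ∀ u ∈ Set.Ioo a b, ContinuousAt X u := fun u hu =>
    tendsto_pi_nhds.2 fun i => tendsto_pi_nhds.2 fun j => (hXd u hu i j).continuousAt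
  have hYc : ∀ u ∈ Set.Ioo a b, ContinuousAt Y u := fun u hu =>
    tendsto_pi_nhds.2 fun i => tendsto_pi_nhds.2 fun j => (hYd u hu i j).continuousAt
  have hcoord : ∀ u (c : Fin n → ℝ) (x : PhaseSpace n),
      (Matrix.of fun i j => v j u i).mulVec c = x →
      baseCoord K x = (X u).mulVec c ∧ fibreCoord K x = (Y u).mulVec c := by
    intro u c x hx
    have hx' : ∀ i, x i = ∑ j, v j u i * c j := fun i => (congrFun hx i).symm
    constructor
    · ext i
      by_cases hi : i ∈ K <;>
        simp [hX, baseCoord_apply, Matrix.mulVec, dotProduct, hi, hx']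
    · ext i
      by_cases hi : i ∈ K <;>
        simp [hY, fibreCoord_apply, Matrix.mulVec, dotProduct, hi, hx']
  have hYX : Y t = S₀ * X t := by
    ext i j
    have hmem : v j t ∈ chart K S₀ := by
      rw [← hLS, hΓ t (hIcc t ht), (hfr t (hIcc t ht)).1]
      exact ⟨Pi.single j 1, by ext i; simp⟩
    exact congrFun (mem_chart.1 hmem) i
  -- A kernel vector of `X t` gives a combination of the frame with zero base coordinates and, by `Y
  -- = S₀ X`, zero fibre coordinates.
  have hdet : (X t).det ≠ 0 := by
    intro h0
    obtain ⟨c, hc, hc0⟩ := Matrix.exists_mulVec_eq_zero_iff.2 h0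
    refine hc ((hfr t (hIcc t ht)).2 c ?_)
    obtain ⟨h1, h2⟩ := hcoord t c (WithLp.toLp 2 _) rfl
    rw [hc0] at h1
    rw [hYX, ← Matrix.mulVec_mulVec, hc0, Matrix.mulVec_zero] at h2
    exact congrArg WithLp.ofLp (eq_zero_of_coord K h1 h2)
  have hdet_ev : ∀ᶠ u in 𝓝 t, (X u).det ≠ 0 := by
    have : ContinuousAt (fun u => (X u).det) t :=
      ContinuousAt.comp (f := X) (continuous_id.matrix_det.continuousAt) (hXc t ht)
    exact this.eventually (isOpen_ne.mem_nhds hdet)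
  have hchart : ∀ u ∈ Set.Ioo a b, (X u).det ≠ 0 → (Γ u).1 = chart K (Y u * (X u)⁻¹) := by
    intro u hu hd
    refine Submodule.eq_of_le_of_finrank_eq (fun x hx => ?_) ?_
    · rw [hΓ u (hIcc u hu), (hfr u (hIcc u hu)).1] at hx
      obtain ⟨c, hc⟩ := hx
      obtain ⟨h1, h2⟩ := hcoord u c x hc
      rw [mem_chart, h1, h2, Matrix.mulVec_mulVec, Matrix.mul_assoc,
        Matrix.nonsing_inv_mul _ (isUnit_iff_ne_zero.2 hd), Matrix.mul_one]
    · rw [(Γ u).2.2, (chartEquiv K _).finrank_eq]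
      simp
  have hinvc : ∀ u ∈ Set.Ioo a b, (X u).det ≠ 0 → ContinuousAt (fun u => (X u)⁻¹) u :=
    fun u hu hd => ContinuousAt.comp (f := X) (continuousAt_inv_of_det_ne_zero hd) (hXc u hu)
  have hprod : Continuous fun p : Matrix (Fin n) (Fin n) ℝ × Matrix (Fin n) (Fin n) ℝ =>
      p.1 * p.2 := continuous_fst.matrix_mul continuous_snd
  have hSt : Y t * (X t)⁻¹ = S₀ := by
    rw [hYX, Matrix.mul_assoc, Matrix.mul_nonsing_inv _ (isUnit_iff_ne_zero.2 hdet),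
      Matrix.mul_one]
  set χ : Fin n → ℝ := fun l => if l ∈ K then 0 else 1 with hχ
  set D : Matrix (Fin n) (Fin n) ℝ := Y' t - S₀ * X' t with hD
  have hSd : ∀ i j, HasDerivAt (fun u => (Y u * (X u)⁻¹) i j) ((D * (X t)⁻¹) i j) t := by
    intro i j
    have h1 : HasDerivAt (fun u => S₀ i j + ∑ l, (Y u i l - ∑ k, S₀ i k * X u k l) * (X u)⁻¹ l j)
        (∑ l, D i l * (X t)⁻¹ l j) t := by
      refine HasDerivAt.const_add _ (HasDerivAt.fun_sum fun l _ => hasDerivAt_mul_of_eq_zero ?_ ?_ ?_)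
      · have h2 := (hYd t ht i l).sub (HasDerivAt.fun_sum (u := Finset.univ) fun k _ =>
          (hXd t ht k l).const_mul (S₀ i k))
        exact h2
      · rw [hYX]
        exact sub_self _
      · exact (((continuous_id.matrix_elem l j).continuousAt).comp (hinvc t ht hdet) :)
    refine h1.congr_of_eventuallyEq ?_
    filter_upwards [hdet_ev] with u hu
    have h3 : Y u * (X u)⁻¹ = S₀ + (Y u - S₀ * X u) * (X u)⁻¹ := by
      rw [Matrix.sub_mul, Matrix.mul_assoc, Matrix.mul_nonsing_inv _ (isUnit_iff_ne_zero.2 hu),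
        Matrix.mul_one, add_sub_cancel]
    rw [h3]
    rfl
  -- For `i ∈ K`, row `i` of `Y'` is that of `-X`, as `q' = p`. The vanishing `K`-block of `S₀`
  -- leaves only rows of `X'` outside `K`, where `X' = Y = S₀ X`. So `R`, which enters `X'` only in
  -- rows of `K`, disappears.
  have hDrow : ∀ i ∈ K, ∀ j, D i j = -((1 + S₀ * (Matrix.diagonal χ * S₀)) * X t) i j := by
    intro i hi j
    have h1 : (S₀ * X' t) i j = (S₀ * (Matrix.diagonal χ * (S₀ * X t))) i j := by
      rw [Matrix.mul_apply, Matrix.mul_apply]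
      refine Finset.sum_congr rfl fun l _ => ?_
      by_cases hl : l ∈ K
      · rw [hKK i hi l hl, zero_mul, zero_mul]
      · rw [Matrix.diagonal_mul, ← hYX]
        simp [hX', hY, hχ, hl, fibreCoord_apply]
    have h2 : Y' t i j = -X t i j := by simp [hY', hX, hi, baseCoord_apply]
    rw [hD, Matrix.sub_apply, h1, h2, Matrix.add_mul, Matrix.one_mul, Matrix.add_apply,
      Matrix.mul_assoc, Matrix.mul_assoc]
    ring
  have hrow : ∀ i ∈ K, ∀ j, (-(D * (X t)⁻¹)) i j = (1 + S₀ * (Matrix.diagonal χ * S₀)) i j := by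
    intro i hi j
    have h1 : (D * (X t)⁻¹) i j =
        -(((1 + S₀ * (Matrix.diagonal χ * S₀)) * X t) * (X t)⁻¹) i j := by
      rw [Matrix.mul_apply, Matrix.mul_apply, ← Finset.sum_neg_distrib]
      exact Finset.sum_congr rfl fun l _ => by rw [hDrow i hi l, neg_mul]
    rw [Matrix.neg_apply, h1, neg_neg, Matrix.mul_assoc,
      Matrix.mul_nonsing_inv _ (isUnit_iff_ne_zero.2 hdet), Matrix.mul_one]
  -- For `y` supported in `K` the negated crossing form is `|y|² + |χ S₀ y|²`, hence at least
  -- `|y|²`.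
  obtain ⟨hl, hr⟩ := eventually_posOn_of_hasDerivAt (K := K) hSd
    (fun i hi j hj => by rw [hSt]; exact hKK i hi j hj) (fun y hy => by
      have h1 : y ⬝ᵥ (-(D * (X t)⁻¹)).mulVec y =
          y ⬝ᵥ (1 + S₀ * (Matrix.diagonal χ * S₀)).mulVec y := by
        refine Finset.sum_congr rfl fun i _ => ?_
        by_cases hi : i ∈ K
        · congr 1
          rw [Matrix.mulVec, Matrix.mulVec, dotProduct, dotProduct]
          exact Finset.sum_congr rfl fun j _ => by rw [hrow i hi j]
        · rw [hy i hi, zero_mul, zero_mul]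
      rw [h1, Matrix.add_mulVec, Matrix.one_mulVec, dotProduct_add, le_add_iff_nonneg_right,
        ← Matrix.mulVec_mulVec, ← Matrix.mulVec_mulVec, Matrix.dotProduct_mulVec,
        ← Matrix.mulVec_transpose, hS₀.eq]
      refine Finset.sum_nonneg fun i _ => ?_
      rw [Matrix.mulVec_diagonal]
      by_cases hi : i ∈ K
      · simp [hχ, hi]
      · simp [hχ, hi, mul_self_nonneg])
  refine ⟨K, fun u => Y u * (X u)⁻¹, hK, ?_, hl, hr⟩
  filter_upwards [hdet_ev, Ioo_mem_nhds ht.1 ht.2] with u hd hu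
  have h := hchart u hu hd
  refine ⟨isSymm_of_isotropic (K := K) (h ▸ (Γ u).2.1), h, ?_⟩
  exact ContinuousAt.comp (f := fun u => (Y u, (X u)⁻¹)) hprod.continuousAt
    ((hYc u hu).prodMk (hinvc u hu hd))

/-! ### The Maslov index of the flow -/

lemma DegenerateCrossing.eventually_ne {Γ : ℝ → LagrangianGrassmannian n} {t : ℝ}
    (h : DegenerateCrossing Γ t) : ∀ᶠ u in 𝓝[≠] t, interDim (Γ u).1 = 0 := by
  obtain ⟨K, S, -, hS, hl, hr⟩ := h
  filter_upwards [eventually_nhdsWithin_of_eventually_nhds hS,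
    eventually_nhdsWithin_of_eventually_nhds (eventually_nhdsWithin_iff.1 hl),
    eventually_nhdsWithin_of_eventually_nhds (eventually_nhdsWithin_iff.1 hr),
    self_mem_nhdsWithin] with u hu hul hur hne
  rw [hu.2.1]
  rcases lt_or_gt_of_ne hne with h | h
  · exact interDim_chart_of_posOn (Or.inl (hul h))
  · exact interDim_chart_of_posOn (Or.inr (hur h))

/-- Isolated crossings are finite in number. -/
lemma finite_crossings (Γ : C(ℝ, LagrangianGrassmannian n)) {a b : ℝ}
    (h : ∀ t ∈ Set.Icc a b, interDim (Γ t).1 ≠ 0 → DegenerateCrossing Γ t) :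
    {t ∈ Set.Icc a b | interDim (Γ t).1 ≠ 0}.Finite := by
  by_contra hinf
  obtain ⟨t, htI, ht⟩ := Set.Infinite.exists_accPt_of_subset_isCompact hinf isCompact_Icc
    fun t ht => ht.1
  -- An accumulation point of crossings can neither be transversal to `σ`, by openness, nor be a
  -- crossing, as these are isolated.
  have hev : ∀ᶠ u in 𝓝[≠] t, interDim (Γ u).1 = 0 := by
    by_cases h0 : interDim (Γ t).1 = 0
    · exact (Γ.continuous.continuousAt.eventually
        (isOpen_interDim_eq_zero.mem_nhds h0)).filter_mono nhdsWithin_le_nhds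
    · exact (h t htI h0).eventually_ne
  rw [accPt_iff_frequently_nhdsNE] at ht
  obtain ⟨u, hu1, hu2⟩ := (ht.and_eventually hev).exists
  exact hu1.2 hu2

lemma homotopicRel_restrict {a b : ℝ} {Γ Η : C(ℝ, LagrangianGrassmannian n)}
    (h : Γ.HomotopicRel Η (Set.Ioo a b)ᶜ) :
    (Γ.restrict (Set.Icc a b)).HomotopicRel (Η.restrict (Set.Icc a b))
      {t | (t : ℝ) = a ∨ (t : ℝ) = b} := by
  obtain ⟨F⟩ := h
  refine ⟨{ toFun := fun p => F (p.1, p.2), continuous_toFun := by fun_prop,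
            map_zero_left := fun u => F.map_zero_left u, map_one_left := fun u => F.map_one_left u,
            prop' := fun s u hu => F.prop s u fun hcon => ?_ }⟩
  rcases hu with hu | hu
  · exact hcon.1.ne' hu
  · exact hcon.2.ne hu

/-- The sign is `-o` because `o * (-o) = -1` turns `S' κ κ < 0` into the required positivity. -/
lemma SimpleCrossing.crossesWithSign {a b : ℝ} {Η : C(ℝ, LagrangianGrassmannian n)}
    {t : Set.Icc a b} (h : SimpleCrossing Η t) (o : ℤˣ) :
    CrossesWithSign o (Η.restrict (Set.Icc a b)) t (-o) := by
  obtain ⟨h1, κ, S, S', hS, hS', hκ⟩ := h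
  refine ⟨h1, κ, S, S', continuous_subtype_val.continuousAt.eventually hS, hS', ?_⟩
  rw [mul_neg, Int.units_mul_self]
  simpa using hκ

/-- A curve with negative definite crossing forms has an intersection index, which is the sum of
the dimensions of its intersections with `σ`, up to the sign of the co-orientation. -/
theorem isIntersectionIndex_of_degenerateCrossing {a b : ℝ}
    (Γ : C(ℝ, LagrangianGrassmannian n)) (B : Finset ℝ) (hB : ∀ t ∈ B, t ∈ Set.Ioo a b)
    (hΓ : ∀ t ∈ Set.Icc a b, interDim (Γ t).1 ≠ 0 ↔ t ∈ B)
    (hdeg : ∀ t ∈ B, DegenerateCrossing Γ t) (o : ℤˣ) :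
    IsIntersectionIndex o (Γ.restrict (Set.Icc a b))
      (-((o : ℤˣ) : ℤ) * ∑ t ∈ B, (interDim (Γ t).1 : ℤ)) := by
  classical
  obtain ⟨Η, T, hTI, hhom, hT, hTs, hcard⟩ := exists_simple_representative (a := a) (b := b) ∅ B Γ
    (by simp) hB (by simp) (by simpa using hΓ) (by simp) hdeg
  refine ⟨fun t ht => ?_, Η.restrict (Set.Icc a b), homotopicRel_restrict hhom,
    T.subtype (· ∈ Set.Icc a b), fun _ => -o, fun t => ?_, fun t ht => ?_, ?_⟩
  · by_contra hne
    have h := hB t ((hΓ t t.2).1 hne)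
    rcases ht with ht | ht
    · exact h.1.ne' ht
    · exact h.2.ne ht
  · rw [mem_maslovCycle, Finset.mem_subtype]
    exact (hT t t.2).symm
  · exact (hTs t (Finset.mem_subtype.1 ht)).crossesWithSign o
  · rw [Finset.sum_const, Finset.card_subtype,
      Finset.filter_true_of_mem fun t ht => Set.Ioo_subset_Icc_self (hTI t ht), hcard]
    simp [mul_comm]

end MaslovIndex

end

theorem mainTheorem2 (n : ℕ) (a b : ℝ) (hab : a < b)
    (R : ℝ → Matrix (Fin n) (Fin n) ℝ)
    (hRcont : ContinuousOn R (Set.Icc a b))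
    (hRsymm : ∀ t ∈ Set.Icc a b, (R t).IsSymm)
    (τ : Submodule ℝ (PhaseSpace n)) (hτ : IsLagrangian τ)
    (ha : interDim (flow R a b τ a) = 0)
    (hb : interDim (flow R a b τ b) = 0) :
    {t ∈ Set.Ioo a b | interDim (flow R a b τ t) ≠ 0}.Finite ∧
    ∃ γ : C(Set.Icc a b, LagrangianGrassmannian n),
      (∀ t, (γ t).1 = flow R a b τ t) ∧
      (∀ m : ℤ, IsIntersectionIndex (-1) γ m ↔
        m = ∑ᶠ t ∈ Set.Ioo a b, (interDim (flow R a b τ t) : ℤ)) ∧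
      (∀ m : ℤ, IsIntersectionIndex 1 γ m ↔
        m = -∑ᶠ t ∈ Set.Ioo a b, (interDim (flow R a b τ t) : ℤ)) := by
  obtain ⟨Γ, hΓ⟩ := exists_flow_curve hab.le hRcont hRsymm hτ
  have hIoo : ∀ t ∈ Set.Icc a b, interDim (Γ t).1 ≠ 0 → t ∈ Set.Ioo a b := by
    intro t ht hne
    rw [hΓ t ht] at hne
    refine ⟨lt_of_le_of_ne ht.1 fun h => hne ?_, lt_of_le_of_ne ht.2 fun h => hne ?_⟩
    · rw [← h, ha]
    · rw [h, hb]
  -- This covers every interior time: where `λ(t)` is transversal to `σ`, `K` is empty and the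
  -- definiteness conditions are vacuous.
  have hdeg : ∀ t ∈ Set.Ioo a b, DegenerateCrossing Γ t := fun t ht =>
    degenerateCrossing_flow hab hRcont hτ hΓ ht
  have hfinΓ := finite_crossings Γ (a := a) (b := b) fun t ht hne => hdeg t (hIoo t ht hne)
  have hset : {t ∈ Set.Ioo a b | interDim (flow R a b τ t) ≠ 0} =
      {t ∈ Set.Icc a b | interDim (Γ t).1 ≠ 0} := by
    ext t
    constructor
    · rintro ⟨h1, h2⟩
      exact ⟨Set.Ioo_subset_Icc_self h1, by rwa [hΓ t (Set.Ioo_subset_Icc_self h1)]⟩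
    · rintro ⟨h1, h2⟩
      exact ⟨hIoo t h1 h2, by rwa [← hΓ t h1]⟩
  have hsum : ∑ᶠ t ∈ Set.Ioo a b, (interDim (flow R a b τ t) : ℤ) =
      ∑ t ∈ hfinΓ.toFinset, (interDim (Γ t).1 : ℤ) := by
    rw [finsum_mem_eq_sum_of_inter_support_eq (t := hfinΓ.toFinset)]
    · refine Finset.sum_congr rfl fun t ht => ?_
      rw [hΓ t ((hfinΓ.mem_toFinset).1 ht).1]
    · ext t
      rw [Set.Finite.coe_toFinset, ← hset]
      simp [and_assoc]
  have hindex : ∀ o : ℤˣ, IsIntersectionIndex o (Γ.restrict (Set.Icc a b))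
      (-((o : ℤˣ) : ℤ) * ∑ᶠ t ∈ Set.Ioo a b, (interDim (flow R a b τ t) : ℤ)) := by
    intro o
    rw [hsum]
    refine isIntersectionIndex_of_degenerateCrossing Γ _ (fun t ht => ?_) (fun t ht => ?_)
      (fun t ht => ?_) o
    · obtain ⟨h1, h2⟩ := hfinΓ.mem_toFinset.1 ht
      exact hIoo t h1 h2
    · rw [hfinΓ.mem_toFinset]
      exact ⟨fun h => ⟨ht, h⟩, fun h => h.2⟩
    · obtain ⟨h1, h2⟩ := hfinΓ.mem_toFinset.1 ht
      exact hdeg t (hIoo t h1 h2)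
  -- In each equivalence, `hindex` gives existence and `IsIntersectionIndex.unique` shows that no
  -- other integer qualifies.
  refine ⟨hset ▸ hfinΓ, Γ.restrict (Set.Icc a b), fun t => hΓ t t.2, fun m => ?_, fun m => ?_⟩
  · have h := hindex (-1)
    simp only [Units.val_neg, Units.val_one, neg_neg, one_mul] at h
    exact ⟨fun hm => hm.unique hab.le h, fun hm => hm ▸ h⟩
  · have h := hindex 1
    simp only [Units.val_one, neg_one_mul] at h
    exact ⟨fun hm => hm.unique hab.le h, fun hm => hm ▸ h⟩
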